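/- Let $H$ be a complex Hilbert space and let $(A,B)$ be a pair of linear operators on $H$ such that: $A$ is skew-adjoint on its domain $D(A)$; $\mathrm iA$ is bounded from below; $B$ is skew-symmetric; $D(A)\subset D(B)$ and, for some constants $a>0$ and $b\ge 0$, $\|B\psi\|\le a\|A\psi\|+b\|\psi\|$ for all $\psi\in D(A)$. Let $\Phi=(\phi_j)_{j\in\mathbf N}$ be a Hilbert basis of $H$ with $A\phi_j=-\mathrm i\lambda_j\phi_j$ for all $j$, where $\lambda_j\in\mathbf R$ and $\lambda_j\to+\infty$. Put $\pi_N\psi=\sum_{j\le N}\langle\phi_j,\psi\rangle\phi_j$ and $\|\psi\|_r=\|(1+|A|)^r\psi\|$. For $\delta\in(0,1)$ let $\mathcal U_{\delta,a}$ be the set of functions $u:\mathbf R\to(-(1-\delta)/a,(1-\delta)/a)$ of bounded variation with $u(t)=0$ for $t\le 0$, and let $TV(u)$ be the total variation of $u$ on $\mathbf R$. For $u\in\mathcal U_{\delta,a}$ and $t\ge 0$ let $\Upsilon^u_t$ be the propagator of $\psi'=(A+u(t)B)\psi$: for piecewise constant $u$ it is the concatenation of the unitary groups $e^{s(A+cB)}$,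 $c$ running through the successive values of $u$; in general it is the pointwise limit of $\Upsilon^{u_n}_t$ for piecewise constant $u_n\in\mathcal U_{\delta,a}$ with $TV(u_n)\le TV(u)$ and $u_n\to u$ almost everywhere. Then for all $\delta\in(0,1)$, $r\in[0,1)$, $n,N\in\mathbf N$ such that $\lambda_k>0$ for every $k>N$, all $\psi_1,\dots,\psi_n\in D(|A|)$, all $u\in\mathcal U_{\delta,a}$, $t\ge 0$ and $1\le j\le n$, the vector $(\mathrm{Id}-\pi_N)\Upsilon^u_t\psi_j$ lies in $D(|A|^r)$ and $$\bigl\|(\mathrm{Id}-\pi_N)\Upsilon^u_t\psi_j\bigr\|_r\;\le\;\frac{e^{\frac{2a}{\delta}TV(u)}\,\bigl(\|\psi_j\|_1+\tfrac ba\|\psi_j\|\bigr)}{\inf_{k>N}\lambda_k^{1-r}} .$$ In particular, if $b=0$, $$\bigl\|(\mathrm{Id}-\pi_N)\Upsilon^u_t\psi_j\bigr\|_r\;\le\;\frac{e^{\frac{2a}{\delta}TV(u)}\,\|\psi_j\|_1}{\inf_{k>N}\lambda_k^{1-r}} .$$ -/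

import Mathlib

open Filter Topology MeasureTheory
open scoped NNReal ENNReal InnerProductSpace

noncomputable section

namespace BilinearSchrodinger

variable {H : Type*} [NormedAddCommGroup H] [InnerProductSpace ℂ H] [CompleteSpace H]

/-- The standing hypothesis on the pair `(A, B)` of unbounded operators, with the constants
`a, b` of the relative bound: `A` is skew-adjoint, `iA` is bounded from below, `B` is
skew-symmetric, and `B` is `A`-bounded, `D(A) ⊆ D(B)` being part of the relative bound. -/
structure KatoPair (A B : H →ₗ.[ℂ] H) (a b : ℝ) : Prop where
  dense_domain : Dense (A.domain : Set H)
  skewAdjoint : A.adjoint = -A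
  boundedBelow : ∃ c : ℝ, ∀ ψ : A.domain,
    c * ‖(ψ : H)‖ ^ 2 ≤ (⟪(ψ : H), Complex.I • A ψ⟫_ℂ).re
  skewSymmetric : ∀ x y : B.domain, ⟪B x, (y : H)⟫_ℂ = -⟪(x : H), B y⟫_ℂ
  a_nonneg : 0 ≤ a
  b_nonneg : 0 ≤ b
  domain_le : A.domain ≤ B.domain
  relBound : ∀ (ψ : H) (hA : ψ ∈ A.domain) (hB : ψ ∈ B.domain),
    ‖B ⟨ψ, hB⟩‖ ≤ a * ‖A ⟨ψ, hA⟩‖ + b * ‖ψ‖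

/-- `A φ_j = -i λ_j φ_j` for every `j`, and `λ_j → +∞`. -/
structure IsDiagonalIn (A : H →ₗ.[ℂ] H) (Φ : HilbertBasis ℕ ℂ H) (lam : ℕ → ℝ) : Prop where
  mem_domain : ∀ j, Φ j ∈ A.domain
  eigen : ∀ j, A ⟨Φ j, mem_domain j⟩ = (-Complex.I * (lam j : ℂ)) • Φ j
  tendsto : Tendsto lam atTop atTop

/-- The operator `∑ c_j ⟨φ_j, ·⟩ φ_j` on its maximal domain `{ψ | ∑ |c_j ⟨φ_j, ψ⟩|² < ∞}`. -/
def diagOp (Φ : HilbertBasis ℕ ℂ H) (c : ℕ → ℝ) : H →ₗ.[ℂ] H where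
  domain :=
    { carrier := {ψ | Memℓp (fun j => (c j : ℂ) * ⟪Φ j, ψ⟫_ℂ) 2}
      add_mem' := by
        intro x y hx hy
        have h := hx.add hy
        have e : (fun j => (c j : ℂ) * ⟪Φ j, x + y⟫_ℂ)
            = (fun j => (c j : ℂ) * ⟪Φ j, x⟫_ℂ) + fun j => (c j : ℂ) * ⟪Φ j, y⟫_ℂ := by
          funext j; simp [mul_add]
        simpa only [Set.mem_ofPred_eq, e] using h
      zero_mem' := by
        have e : (fun j => (c j : ℂ) * ⟪Φ j, (0 : H)⟫_ℂ) = 0 := by funext j; simp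
        simpa only [Set.mem_ofPred_eq, e] using zero_memℓp
      smul_mem' := by
        intro z x hx
        have h := hx.const_smul z
        have e : (fun j => (c j : ℂ) * ⟪Φ j, z • x⟫_ℂ)
            = z • fun j => (c j : ℂ) * ⟪Φ j, x⟫_ℂ := by
          funext j; simp; ring
        simpa only [Set.mem_ofPred_eq, e] using h }
  toFun :=
    { toFun := fun ψ => Φ.repr.symm ⟨fun j => (c j : ℂ) * ⟪Φ j, (ψ : H)⟫_ℂ, ψ.2⟩
      map_add' := by
        intro x y
        rw [← map_add]
        congr 1
        ext j
        simp [mul_add]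
        rfl
      map_smul' := by
        intro z x
        rw [RingHom.id_apply, ← map_smul]
        congr 1
        ext j
        simp
        ring }

/-- For `A` diagonal in `Φ` with eigenvalues `-i λ_j`, the operator `(1 + |A|)^r`; its domain
is `D(|A|^r)`, and `‖ψ‖_r` is the norm of its value at `ψ`. -/
def onePlusAbsPow (Φ : HilbertBasis ℕ ℂ H) (lam : ℕ → ℝ) (r : ℝ) : H →ₗ.[ℂ] H :=
  diagOp Φ fun j => (1 + |lam j|) ^ r

/-- The orthogonal projection `π_N ψ = ∑_{j ≤ N} ⟨φ_j, ψ⟩ φ_j`. -/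
def basisProj (Φ : HilbertBasis ℕ ℂ H) (N : ℕ) (ψ : H) : H :=
  ∑ j ∈ Finset.range (N + 1), ⟪Φ j, ψ⟫_ℂ • Φ j

/-- `U` is the strongly continuous unitary group with generator `L`. -/
structure IsUnitaryGroupOf (L : H →ₗ.[ℂ] H) (U : ℝ → H →L[ℂ] H) : Prop where
  zero : U 0 = 1
  add : ∀ s t, U (s + t) = U s * U t
  norm_map : ∀ t ψ, ‖U t ψ‖ = ‖ψ‖
  continuous : ∀ ψ, Continuous fun t => U t ψ
  generator : ∀ ψ φ, (ψ, φ) ∈ L.graph ↔ HasDerivAt (fun t => U t ψ) φ 0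

open Classical in
/-- The unitary group `t ↦ e^{tL}` generated by `L`. (By Stone's theorem it exists, and is
unique, exactly when `L` is skew-adjoint.) -/
def unitaryGroup (L : H →ₗ.[ℂ] H) : ℝ → H →L[ℂ] H :=
  if h : ∃ U, IsUnitaryGroupOf L U then h.choose else 0

/-- A piecewise constant control on `(0, ∞)`: finitely many pieces
(duration `> 0`, value), followed
by a last value that is kept forever. -/
structure StepControl where
  pieces : List (Set.Ioi (0 : ℝ) × ℝ)
  last : ℝ

/-- The value at time `t` of the control given by a list of pieces and a last value; it
vanishes for `t ≤ 0` and is left-continuous. -/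
def stepValue (c : ℝ) : List (Set.Ioi (0 : ℝ) × ℝ) → ℝ → ℝ
  | [], t => if t ≤ 0 then 0 else c
  | (τ, d) :: l, t => if t ≤ 0 then 0 else if t ≤ (τ : ℝ) then d else stepValue c l (t - τ)

/-- The concatenation `⋯ e^{τ₂(A + d₂ B)} e^{τ₁(A + d₁ B)}` up to time `t ≥ 0`. -/
def stepFlow (A B : H →ₗ.[ℂ] H) (c : ℝ) : List (Set.Ioi (0 : ℝ) × ℝ) → ℝ → H →L[ℂ] H
  | [], t => unitaryGroup (A + (c : ℂ) • B) t
  | (τ, d) :: l, t =>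
      if t ≤ (τ : ℝ) then unitaryGroup (A + (d : ℂ) • B) t
      else stepFlow A B c l (t - τ) * unitaryGroup (A + (d : ℂ) • B) τ

/-- The control as a function `ℝ → ℝ`. -/
def StepControl.toFun (v : StepControl) : ℝ → ℝ := stepValue v.last v.pieces

/-- The propagator `Υ^v_t` of a piecewise constant control `v`. -/
def StepControl.flow (A B : H →ₗ.[ℂ] H) (v : StepControl) : ℝ → H →L[ℂ] H :=
  stepFlow A B v.last v.pieces

/-- The total variation of `u` on the real line, a real number when `u` is of bounded
variation. -/
def totalVariation (u : ℝ → ℝ) : ℝ := (eVariationOn u Set.univ).toReal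

/-- The set `𝒰_{δ,a}` of controls of bounded variation on `ℝ` that vanish on `(-∞, 0]` and take
their values in `(-(1-δ)/a, (1-δ)/a)`. -/
def admissible (δ a : ℝ) : Set (ℝ → ℝ) :=
  {u | BoundedVariationOn u Set.univ ∧ (∀ t ≤ 0, u t = 0) ∧
    ∀ t, u t ∈ Set.Ioo (-((1 - δ) / a)) ((1 - δ) / a)}

/-- `(v_n)` is a sequence of piecewise constant elements of `𝒰_{δ,a}` converging to `u`:
the total variations are at most that of `u`, and `v_n → u` almost everywhere. -/
structure Approximates (δ a : ℝ) (u : ℝ → ℝ) (v : ℕ → StepControl) : Prop where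
  mem : ∀ n, (v n).toFun ∈ admissible δ a
  variation_le : ∀ n, totalVariation (v n).toFun ≤ totalVariation u
  tendsto : ∀ᵐ t : ℝ, Tendsto (fun n => (v n).toFun t) atTop (𝓝 (u t))

/-- `x = Υ^u_t ψ`: piecewise constant approximations `v_n` of `u` exist, and `Υ^{v_n}_t ψ → x`
for all of them. -/
def IsPropagatorValue (δ a : ℝ) (A B : H →ₗ.[ℂ] H) (u : ℝ → ℝ) (t : ℝ) (ψ x : H) : Prop :=
  (∃ v, Approximates δ a u v) ∧
    ∀ v, Approximates δ a u v → Tendsto (fun n => (v n).flow A B t ψ) atTop (𝓝 x)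

open Classical in
/-- The propagator `Υ^u_t` of `ψ' = (A + u(t) B) ψ` for `u ∈ 𝒰_{δ,a}`. -/
def propagator (δ a : ℝ) (A B : H →ₗ.[ℂ] H) (u : ℝ → ℝ) (t : ℝ) (ψ : H) : H :=
  if h : ∃ x, IsPropagatorValue δ a A B u t ψ x then h.choose else 0

end BilinearSchrodinger

end

open BilinearSchrodinger

set_option linter.unusedSectionVars false

noncomputable section

namespace BilinearSchrodinger

variable {H : Type*} [NormedAddCommGroup H] [InnerProductSpace ℂ H] [CompleteSpace H]

/-! While the control has a constant value `c`, the flow is a unitary group commuting with `A + cB`,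
so it conserves `‖(A + cB)x‖`, `‖x‖` and `‖(A + cB - i)x‖`. Growth can only come from changing `c`.
Since `|c| a ≤ 1 - δ`, the relative bound can be absorbed: `‖Bx‖ ≤ (a/δ) M_c(x)`, where `M_c(x) =
‖(A + cB)x‖ + (b/a)‖x‖`. Hence a jump of size `h` multiplies `M` by at most `1 + (a/δ)h ≤
exp((a/δ)h)`. Each jump is paid twice, once to pass to the new value and once to return at the end
to the value 0, where `A` alone is seen; this is the 2 in the exponent (`energy_growth_change`,
`stepFlow_energy`). The jumps add up to at most the total variation.

The energy `M_0` controls only `|λ_k| |x_k|`, which is too weak for the weight `(1 + λ_k)^r` with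
the stated constant. The vector `(A - i)x` has coefficients of modulus `|1 + λ_k| |x_k|`, and its
norm grows at most by `(exp(⋯) - 1) M_0(x)`. Initially both quantities are bounded through `‖ψ‖_1`,
and for `k > N` one has `(1 + λ_k)^r ≤ (1 + λ_k) / inf λ^(1-r)`.

The objects must also be shown to exist. The groups come from Stone's theorem by Yosida
approximation together with Kato–Rellich. The propagator is a limit because step flows are stable in
`L¹` of the control, given a uniform energy bound (`norm_stepFlow_sub_sq_le`). Bounds on finitely
many coefficients pass to this limit. -/

theorem inner_eq_re_zero_of_skew {L : H →ₗ.[ℂ] H}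
    (hskew : ∀ x y : L.domain, ⟪L x, (y : H)⟫_ℂ = -⟪(x : H), L y⟫_ℂ) (x : L.domain) :
    (⟪(x : H), L x⟫_ℂ).re = 0 := by
  have h := congrArg Complex.re (hskew x x)
  rw [← inner_conj_symm, Complex.conj_re, Complex.neg_re] at h
  linarith

/-! ### Exponentials of bounded skew-adjoint operators. -/

section ExpSkew

variable {K K' : H →L[ℂ] H}

theorem smul_mem_skewAdjoint_ofReal (hK : K ∈ skewAdjoint (H →L[ℂ] H)) (t : ℝ) :
    (t : ℂ) • K ∈ skewAdjoint (H →L[ℂ] H) := by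
  rw [skewAdjoint.mem_iff] at hK ⊢
  rw [star_smul, hK]
  simp

theorem norm_exp_skew_apply (hK : K ∈ skewAdjoint (H →L[ℂ] H)) (t : ℝ) (x : H) :
    ‖NormedSpace.exp ((t : ℂ) • K) x‖ = ‖x‖ := by
  let _ : NormedAlgebra ℚ (H →L[ℂ] H) := NormedAlgebra.restrictScalars ℚ ℂ _
  have h := NormedSpace.exp_mem_unitary_of_mem_skewAdjoint (smul_mem_skewAdjoint_ofReal hK t)
  exact ContinuousLinearMap.norm_map_of_mem_unitary h x

theorem exp_skew_add (K : H →L[ℂ] H) (s t : ℝ) :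
    NormedSpace.exp (((s + t : ℝ) : ℂ) • K)
      = NormedSpace.exp ((s : ℂ) • K) * NormedSpace.exp ((t : ℂ) • K) := by
  let _ : NormedAlgebra ℚ (H →L[ℂ] H) := NormedAlgebra.restrictScalars ℚ ℂ _
  rw [← NormedSpace.exp_add_of_commute (((Commute.refl K).smul_left _).smul_right _),
    ← add_smul, Complex.ofReal_add]

theorem hasDerivAt_exp_skew_apply (K : H →L[ℂ] H) (x : H) (t : ℝ) :
    HasDerivAt (fun s : ℝ => NormedSpace.exp ((s : ℂ) • K) x)
      (NormedSpace.exp ((t : ℂ) • K) (K x)) t := by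
  have h := (hasDerivAt_exp_smul_const (𝕂 := ℂ) K (t : ℂ)).clm_apply (hasDerivAt_const (t : ℂ) x)
  have h' := h.scomp t Complex.ofRealCLM.hasDerivAt
  simpa [Function.comp_def] using h'

theorem norm_exp_skew_sub_le (hK : K ∈ skewAdjoint (H →L[ℂ] H)) (t : ℝ) (x : H) :
    ‖NormedSpace.exp ((t : ℂ) • K) x - x‖ ≤ |t| * ‖K x‖ := by
  have h := Convex.norm_image_sub_le_of_norm_hasDerivWithin_le (s := Set.univ) (x := (0 : ℝ))
    (y := t) (C := ‖K x‖)
    (fun s _ => (hasDerivAt_exp_skew_apply K x s).hasDerivWithinAt)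
    (fun s _ => (norm_exp_skew_apply hK s (K x)).le) convex_univ trivial trivial
  simpa [mul_comm] using h

/-- Commutation factors `e^{tK}` as `e^{tK'} e^{t(K-K')}` with an isometric first factor. No
operator norm enters the bound, so it survives when the norms of the approximants blow up. -/
theorem norm_exp_skew_sub_exp_skew_le (hK : K ∈ skewAdjoint (H →L[ℂ] H))
    (hK' : K' ∈ skewAdjoint (H →L[ℂ] H)) (hc : Commute K K') (t : ℝ) (x : H) :
    ‖NormedSpace.exp ((t : ℂ) • K) x - NormedSpace.exp ((t : ℂ) • K') x‖
      ≤ |t| * ‖K x - K' x‖ := by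
  let _ : NormedAlgebra ℚ (H →L[ℂ] H) := NormedAlgebra.restrictScalars ℚ ℂ _
  have e : NormedSpace.exp ((t : ℂ) • K)
      = NormedSpace.exp ((t : ℂ) • K') * NormedSpace.exp ((t : ℂ) • (K - K')) := by
    rw [← NormedSpace.exp_add_of_commute, ← smul_add, add_sub_cancel]
    exact ((hc.symm.sub_right (Commute.refl K')).smul_left _).smul_right _
  rw [e, mul_apply_eq_comp, ← map_sub, norm_exp_skew_apply hK']
  exact norm_exp_skew_sub_le (sub_mem hK hK') t x

theorem norm_exp_skew_sub_exp_skew_le_time (hK : K ∈ skewAdjoint (H →L[ℂ] H)) (s t : ℝ) (x : H) :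
    ‖NormedSpace.exp ((t : ℂ) • K) x - NormedSpace.exp ((s : ℂ) • K) x‖ ≤ |t - s| * ‖K x‖ := by
  have e : NormedSpace.exp ((t : ℂ) • K)
      = NormedSpace.exp ((s : ℂ) • K) * NormedSpace.exp (((t - s : ℝ) : ℂ) • K) := by
    rw [← exp_skew_add, add_sub_cancel]
  rw [e, mul_apply_eq_comp, ← map_sub, norm_exp_skew_apply hK]
  exact norm_exp_skew_sub_le hK _ x

/-- The first order Taylor remainder of `t ↦ e^{tK} x`, controlled by a vector `z` near `K x`. -/
theorem norm_exp_skew_taylor_le (hK : K ∈ skewAdjoint (H →L[ℂ] H)) (t : ℝ) (x z : H) :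
    ‖NormedSpace.exp ((t : ℂ) • K) x - x - (t : ℂ) • K x‖
      ≤ |t| * (2 * ‖K x - z‖ + |t| * ‖K z‖) := by
  have hd : ∀ s : ℝ, HasDerivAt (fun s : ℝ => NormedSpace.exp ((s : ℂ) • K) x - (s : ℂ) • K x)
      (NormedSpace.exp ((s : ℂ) • K) (K x) - K x) s := by
    intro s
    have h := (Complex.ofRealCLM.hasDerivAt (x := s)).smul_const (K x)
    simpa using (hasDerivAt_exp_skew_apply K x s).fun_sub h
  have hb : ∀ s ∈ Set.uIcc 0 t, ‖NormedSpace.exp ((s : ℂ) • K) (K x) - K x‖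
      ≤ 2 * ‖K x - z‖ + |t| * ‖K z‖ := by
    intro s hs
    have hst : |s| ≤ |t| := by
      simpa using Set.abs_sub_left_of_mem_uIcc hs
    have e : NormedSpace.exp ((s : ℂ) • K) (K x) - K x
        = NormedSpace.exp ((s : ℂ) • K) (K x - z) - (K x - z)
          + (NormedSpace.exp ((s : ℂ) • K) z - z) := by
      rw [map_sub]; abel
    rw [e]
    refine (norm_add_le _ _).trans ?_
    have h1 := norm_sub_le (NormedSpace.exp ((s : ℂ) • K) (K x - z)) (K x - z)
    rw [norm_exp_skew_apply hK] at h1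
    have h2 := (norm_exp_skew_sub_le hK s z).trans
      (mul_le_mul_of_nonneg_right hst (norm_nonneg (K z)))
    linarith
  have h := Convex.norm_image_sub_le_of_norm_hasDerivWithin_le (s := Set.uIcc 0 t) (x := (0 : ℝ))
    (y := t) (fun s _ => (hd s).hasDerivWithinAt) hb (convex_uIcc 0 t) Set.left_mem_uIcc
    Set.right_mem_uIcc
  have e : NormedSpace.exp ((t : ℂ) • K) x - x - (t : ℂ) • K x
      = NormedSpace.exp ((t : ℂ) • K) x - (t : ℂ) • K x
        - (NormedSpace.exp (((0 : ℝ) : ℂ) • K) x - ((0 : ℝ) : ℂ) • K x) := by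
    simp only [Complex.ofReal_zero, zero_smul, NormedSpace.exp_zero,
      one_apply_eq_self, sub_zero]
    abel
  rw [e, mul_comm]
  simpa using h

end ExpSkew

/-! ### Stone's theorem by Yosida approximation. -/

/-- Bounded sequences of operators converging on a dense set converge everywhere. -/
theorem cauchySeq_of_dense {K : ℕ → H →L[ℂ] H} {C : ℝ} (hC : ∀ n x, ‖K n x‖ ≤ C * ‖x‖)
    {D : Set H} (hD : Dense D) (h : ∀ x ∈ D, CauchySeq fun n => K n x) (x : H) :
    CauchySeq fun n => K n x := by
  rw [Metric.cauchySeq_iff]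
  intro ε hε
  have hC1 : 0 < |C| + 1 := by positivity
  obtain ⟨y, hyD, hy⟩ := hD.exists_dist_lt x (show 0 < ε / (4 * (|C| + 1)) by positivity)
  obtain ⟨N, hN⟩ := Metric.cauchySeq_iff.1 (h y hyD) (ε / 2) (by positivity)
  refine ⟨N, fun m hm n hn => ?_⟩
  have hb : ∀ k, ‖K k x - K k y‖ < ε / 4 := by
    intro k
    rw [← map_sub]
    refine (hC k _).trans_lt ?_
    rw [dist_eq_norm, lt_div_iff₀ (by positivity)] at hy
    have := mul_le_mul_of_nonneg_right ((le_abs_self C).trans (lt_add_one |C|).le)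
      (norm_nonneg (x - y))
    linarith
  have h1 := hN m hm n hn
  rw [dist_eq_norm] at h1 ⊢
  have e : K m x - K n x = (K m x - K m y) + (K m y - K n y) - (K n x - K n y) := by abel
  rw [e]
  have h2 := norm_sub_le ((K m x - K m y) + (K m y - K n y)) (K n x - K n y)
  have h3 := norm_add_le (K m x - K m y) (K m y - K n y)
  have := hb m
  have := hb n
  linarith

theorem tendsto_of_dense {K : ℕ → H →L[ℂ] H} {C : ℝ} (hC : ∀ n x, ‖K n x‖ ≤ C * ‖x‖)
    {D : Set H} (hD : Dense D) (h : ∀ x ∈ D, Tendsto (fun n => K n x) atTop (𝓝 x)) (x : H) :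
    Tendsto (fun n => K n x) atTop (𝓝 x) := by
  obtain ⟨y, hy⟩ := cauchySeq_tendsto_of_complete
    (cauchySeq_of_dense hC hD (fun z hz => (h z hz).cauchySeq) x)
  suffices hyx : ‖y - x‖ ≤ 0 by
    rw [norm_le_zero_iff, sub_eq_zero] at hyx
    rwa [hyx] at hy
  refine le_of_forall_pos_le_add fun ε hε => ?_
  obtain ⟨z, hzD, hz⟩ := hD.exists_dist_lt x (show 0 < ε / (|C| + 1) by positivity)
  have h1 : ‖y - z‖ ≤ C * ‖x - z‖ := by
    refine le_of_tendsto (hy.sub (h z hzD)).norm (Eventually.of_forall fun n => ?_)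
    rw [← map_sub]
    exact hC n _
  rw [dist_eq_norm, lt_div_iff₀ (by positivity)] at hz
  have e : y - x = (y - z) - (x - z) := by abel
  have h2 := norm_sub_le (y - z) (x - z)
  rw [← e] at h2
  have h3 := mul_le_mul_of_nonneg_right (le_abs_self C) (norm_nonneg (x - z))
  linarith

/-- The unitary group obtained as the limit of the groups of commuting bounded skew-adjoint
operators that converge pointwise on a dense set. -/
theorem exists_unitaryGroup_of_tendsto {K : ℕ → H →L[ℂ] H}
    (hK : ∀ n, K n ∈ skewAdjoint (H →L[ℂ] H)) (hc : ∀ m n, Commute (K m) (K n))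
    {D : Set H} (hD : Dense D) {G : H → H}
    (hG : ∀ x ∈ D, Tendsto (fun n => K n x) atTop (𝓝 (G x))) :
    ∃ U : ℝ → H →L[ℂ] H, U 0 = 1 ∧ (∀ s t, U (s + t) = U s * U t) ∧ (∀ t x, ‖U t x‖ = ‖x‖) ∧
      (∀ x, Continuous fun t => U t x) ∧ ∀ x ∈ D, HasDerivAt (fun t => U t x) (G x) 0 := by
  set E : ℕ → ℝ → H →L[ℂ] H := fun n t => NormedSpace.exp ((t : ℂ) • K n) with hE
  have hEn : ∀ n t x, ‖E n t x‖ = ‖x‖ := fun n t x => norm_exp_skew_apply (hK n) t x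
  have hcauchy : ∀ t x, CauchySeq fun n => E n t x := by
    intro t x
    refine cauchySeq_of_dense (C := 1) (fun n x => by rw [hEn, one_mul]) hD (fun y hy => ?_) x
    have h0 : Tendsto (fun p : ℕ × ℕ => |t| * dist (K p.1 y) (K p.2 y)) atTop (𝓝 0) := by
      simpa using (cauchySeq_iff_tendsto_dist_atTop_0.1 (hG y hy).cauchySeq).const_mul |t|
    rw [cauchySeq_iff_tendsto_dist_atTop_0]
    refine squeeze_zero (fun _ => dist_nonneg) (fun p => ?_) h0
    rw [dist_eq_norm, dist_eq_norm]
    exact norm_exp_skew_sub_exp_skew_le (hK _) (hK _) (hc _ _) t y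
  choose V hV using fun t x => cauchySeq_tendsto_of_complete (hcauchy t x)
  have hVn : ∀ t x, ‖V t x‖ = ‖x‖ := fun t x =>
    tendsto_nhds_unique (hV t x).norm (by simp [hEn])
  have hVadd : ∀ t x y, V t (x + y) = V t x + V t y := fun t x y =>
    tendsto_nhds_unique (hV t (x + y)) (by simpa using (hV t x).add (hV t y))
  have hVsmul : ∀ t (c : ℂ) x, V t (c • x) = c • V t x := fun t c x =>
    tendsto_nhds_unique (hV t (c • x)) (by simpa using (hV t x).const_smul c)
  let U : ℝ → H →L[ℂ] H := fun t =>
    LinearMap.mkContinuous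
      { toFun := V t, map_add' := hVadd t, map_smul' := fun c x => hVsmul t c x } 1
      (fun x => by simp [hVn])
  have hU : ∀ t x, Tendsto (fun n => E n t x) atTop (𝓝 (U t x)) := hV
  have hUn : ∀ t x, ‖U t x‖ = ‖x‖ := hVn
  have hlip : ∀ x ∈ D, ∀ s t, ‖U t x - U s x‖ ≤ |t - s| * ‖G x‖ := fun x hx s t =>
    le_of_tendsto_of_tendsto' ((hU t x).sub (hU s x)).norm ((hG x hx).norm.const_mul _)
      (fun n => norm_exp_skew_sub_exp_skew_le_time (hK n) s t x)
  refine ⟨U, ?_, ?_, hUn, ?_, ?_⟩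
  · ext x
    refine tendsto_nhds_unique (hU 0 x) ?_
    simp [hE]
  · intro s t
    ext x
    refine tendsto_nhds_unique (hU (s + t) x) ?_
    have h1 : Tendsto (fun n => E n s (U t x)) atTop (𝓝 (U s (U t x))) := hU s _
    have h2 : Tendsto (fun n => E n s (E n t x - U t x)) atTop (𝓝 0) := by
      rw [tendsto_zero_iff_norm_tendsto_zero]
      simp only [hEn]
      rw [← tendsto_zero_iff_norm_tendsto_zero]
      simpa using (hU t x).sub_const (U t x)
    have h3 := h2.add h1
    rw [zero_add] at h3
    refine h3.congr fun n => ?_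
    simp only [hE, exp_skew_add, mul_apply_eq_comp, map_sub]
    abel
  · intro x
    rw [Metric.continuous_iff]
    intro s ε hε
    obtain ⟨z, hzD, hz⟩ := hD.exists_dist_lt x (show 0 < ε / 4 by positivity)
    refine ⟨ε / (4 * (‖G z‖ + 1)), by positivity, fun t ht => ?_⟩
    rw [dist_eq_norm] at hz ⊢
    rw [Real.dist_eq, lt_div_iff₀ (by positivity)] at ht
    have e : U t x - U s x = U t (x - z) + (U t z - U s z) - U s (x - z) := by
      simp only [map_sub]; abel
    rw [e]
    have h1 := norm_sub_le (U t (x - z) + (U t z - U s z)) (U s (x - z))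
    have h2 := norm_add_le (U t (x - z)) (U t z - U s z)
    rw [hUn] at h1 h2
    have h3 := hlip z hzD s t
    have h4 : 0 ≤ |t - s| := abs_nonneg _
    nlinarith
  · intro x hx
    -- The derivative `G x` need not lie in `D`, so the second-order term is estimated at a nearby
    -- `z ∈ D`. With `‖G x - z‖ < ε/4` and `|t| ‖G z‖ < ε/2` the remainder is at most `ε |t|`.
    have htaylor : ∀ t, ∀ z ∈ D,
        ‖U t x - x - (t : ℂ) • G x‖ ≤ |t| * (2 * ‖G x - z‖ + |t| * ‖G z‖) := fun t z hz =>
      le_of_tendsto_of_tendsto'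
        (((hU t x).sub_const x).sub ((hG x hx).const_smul (t : ℂ))).norm
        (((((hG x hx).sub_const z).norm.const_mul 2).add
          ((hG z hz).norm.const_mul |t|)).const_mul |t|)
        (fun n => norm_exp_skew_taylor_le (hK n) t x z)
    have hU0 : U 0 x = x := by
      refine tendsto_nhds_unique (hU 0 x) ?_
      simp [hE]
    rw [hasDerivAt_iff_isLittleO_nhds_zero, Asymptotics.isLittleO_iff]
    intro ε hε
    obtain ⟨z, hzD, hz⟩ := hD.exists_dist_lt (G x) (show 0 < ε / 4 by positivity)
    rw [dist_eq_norm] at hz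
    have hev : ∀ᶠ t : ℝ in 𝓝 0, |t| < ε / (2 * (‖G z‖ + 1)) := by
      have : Tendsto (fun t : ℝ => |t|) (𝓝 0) (𝓝 0) := by
        simpa using (continuous_abs.tendsto (0 : ℝ))
      exact this.eventually_lt_const (by positivity)
    filter_upwards [hev] with t ht
    rw [lt_div_iff₀ (by positivity)] at ht
    simp only [zero_add, hU0]
    have h1 := htaylor t z hzD
    rw [Complex.coe_smul] at h1
    refine h1.trans ?_
    rw [mul_comm, Real.norm_eq_abs]
    refine mul_le_mul_of_nonneg_right ?_ (abs_nonneg t)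
    have h4 : 0 ≤ |t| := abs_nonneg t
    nlinarith

/-- Skew-symmetry gives `Re ⟨x, μx - Lx⟩ = μ‖x‖²`; then Cauchy–Schwarz. -/
theorem norm_smul_sub_ge_of_skew {L : H →ₗ.[ℂ] H}
    (hskew : ∀ x y : L.domain, ⟪L x, (y : H)⟫_ℂ = -⟪(x : H), L y⟫_ℂ) (μ : ℝ) (x : L.domain) :
    |μ| * ‖(x : H)‖ ≤ ‖(μ : ℂ) • (x : H) - L x‖ := by
  rcases eq_or_ne (x : H) 0 with h | h
  · rw [h]; simp
  have h1 : (⟪(x : H), (μ : ℂ) • (x : H) - L x⟫_ℂ).re = μ * ‖(x : H)‖ ^ 2 := by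
    rw [inner_sub_right, inner_smul_right, Complex.sub_re, inner_eq_re_zero_of_skew hskew x,
      inner_self_eq_norm_sq_to_K]
    simp [← Complex.ofReal_pow]
  have h2 := (Complex.abs_re_le_norm _).trans (norm_inner_le_norm (𝕜 := ℂ) (x : H)
    ((μ : ℂ) • (x : H) - L x))
  rw [h1, abs_mul, abs_of_nonneg (sq_nonneg ‖(x : H)‖), pow_two] at h2
  have h3 : 0 < ‖(x : H)‖ := norm_pos_iff.2 h
  refine le_of_mul_le_mul_left ?_ h3
  linarith

/-- The resolvent of a skew-symmetric operator `L` at a real point where `μ - L` is onto. -/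
theorem exists_resolvent_of_skew {L : H →ₗ.[ℂ] H}
    (hskew : ∀ x y : L.domain, ⟪L x, (y : H)⟫_ℂ = -⟪(x : H), L y⟫_ℂ) {μ : ℝ} (hμ : μ ≠ 0)
    (hsurj : ∀ y, ∃ x : L.domain, (μ : ℂ) • (x : H) - L x = y) :
    ∃ R : H →L[ℂ] H, (∀ y, |μ| * ‖R y‖ ≤ ‖y‖) ∧
      (∀ y, ∃ h : R y ∈ L.domain, (μ : ℂ) • R y - L ⟨R y, h⟩ = y) ∧
      ∀ x : L.domain, R ((μ : ℂ) • (x : H) - L x) = x := by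
  choose S hS using hsurj
  have hinj : ∀ x y : L.domain, (μ : ℂ) • (x : H) - L x = (μ : ℂ) • (y : H) - L y → x = y := by
    intro x y h
    have h1 := norm_smul_sub_ge_of_skew hskew μ (x - y)
    rw [L.map_sub] at h1
    have e : (μ : ℂ) • ((x - y : L.domain) : H) - (L x - L y)
        = ((μ : ℂ) • (x : H) - L x) - ((μ : ℂ) • (y : H) - L y) := by
      rw [Submodule.coe_sub, smul_sub]; abel
    rw [e, h, sub_self, norm_zero] at h1
    have h2 : ‖((x - y : L.domain) : H)‖ ≤ 0 := by
      by_contra h3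
      exact absurd h1 (not_le.2 (mul_pos (abs_pos.2 hμ) (not_le.1 h3)))
    have h3 := norm_le_zero_iff.1 h2
    rw [Submodule.coe_sub, sub_eq_zero] at h3
    exact Subtype.ext h3
  have hadd : ∀ x y, S (x + y) = S x + S y := fun x y => hinj _ _ <| by
    rw [hS, L.map_add, Submodule.coe_add, smul_add, add_sub_add_comm, hS, hS]
  have hsmul : ∀ (c : ℂ) x, S (c • x) = c • S x := fun c x => hinj _ _ <| by
    rw [hS, L.map_smul, Submodule.coe_smul, smul_comm, ← smul_sub, hS]
  have hb : ∀ y, |μ| * ‖(S y : H)‖ ≤ ‖y‖ := fun y => by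
    have := norm_smul_sub_ge_of_skew hskew μ (S y)
    rwa [hS] at this
  refine ⟨LinearMap.mkContinuous
      { toFun := fun y => (S y : H)
        map_add' := fun x y => by rw [hadd, Submodule.coe_add]
        map_smul' := fun c x => by rw [hsmul, Submodule.coe_smul, RingHom.id_apply] } |μ|⁻¹
      (fun y => ?_), hb, fun y => ⟨(S y).2, hS y⟩, fun x => ?_⟩
  · rw [inv_mul_eq_div, le_div_iff₀ (abs_pos.2 hμ), mul_comm]
    exact hb y
  · exact congrArg Subtype.val (hinj _ _ (hS _))

/-- For `x = R S y` the vector `(μ - L)x = S y` lies in the domain, hence so does `L x`, and the two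
factors may be exchanged: `(μ - L)(ν - L)x = y`. So `R y = (ν - L)x`, and applying `S` returns `x`.
-/
theorem resolvent_mul_comm {L : H →ₗ.[ℂ] H} {μ ν : ℝ} {R S : H →L[ℂ] H}
    (hR : ∀ y, ∃ h : R y ∈ L.domain, (μ : ℂ) • R y - L ⟨R y, h⟩ = y)
    (hS : ∀ y, ∃ h : S y ∈ L.domain, (ν : ℂ) • S y - L ⟨S y, h⟩ = y)
    (hR' : ∀ x : L.domain, R ((μ : ℂ) • (x : H) - L x) = x)
    (hS' : ∀ x : L.domain, S ((ν : ℂ) • (x : H) - L x) = x) : Commute R S := by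
  ext y
  obtain ⟨h1, e1⟩ := hR (S y)
  obtain ⟨h2, e2⟩ := hS y
  change R (S y) = S (R y)
  set x := R (S y) with hx
  have hLx : L ⟨x, h1⟩ = (μ : ℂ) • x - S y := by rw [← e1]; abel
  have hLx' : L ⟨x, h1⟩ ∈ L.domain := by
    rw [hLx]; exact L.domain.sub_mem (L.domain.smul_mem _ h1) h2
  let w : L.domain := (ν : ℂ) • ⟨x, h1⟩ - ⟨L ⟨x, h1⟩, hLx'⟩
  let w' : L.domain := (μ : ℂ) • ⟨x, h1⟩ - ⟨L ⟨x, h1⟩, hLx'⟩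
  have hw' : w' = ⟨S y, h2⟩ := Subtype.ext (by
    change (μ : ℂ) • x - L ⟨x, h1⟩ = S y
    exact e1)
  have hLw' : (ν : ℂ) • (w' : H) - L w' = y := by rw [hw']; exact e2
  have hw : (μ : ℂ) • (w : H) - L w = y := by
    rw [← hLw']
    simp only [w, w', L.map_sub, L.map_smul, Submodule.coe_sub, Submodule.coe_smul]
    rw [smul_sub, smul_sub, smul_comm]
    abel
  have hRy : R y = w := by rw [← hw]; exact hR' w
  rw [hRy]
  exact (hS' ⟨x, h1⟩).symm

/-- On the domain, `m R x - x = R L x` has norm at most `‖L x‖ / |m|`; density and `‖m R‖ ≤ 1` do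
the rest. -/
theorem tendsto_smul_resolvent {L : H →ₗ.[ℂ] H} (hd : Dense (L.domain : Set H)) {m : ℕ → ℝ}
    (hm0 : ∀ n, m n ≠ 0) (hm : Tendsto (fun n => |m n|) atTop atTop) {R : ℕ → H →L[ℂ] H}
    (hb : ∀ n y, |m n| * ‖R n y‖ ≤ ‖y‖)
    (hR' : ∀ n (x : L.domain), R n ((m n : ℂ) • (x : H) - L x) = x) (y : H) :
    Tendsto (fun n => (m n : ℂ) • R n y) atTop (𝓝 y) := by
  refine tendsto_of_dense (K := fun n => (m n : ℂ) • R n) (C := 1) (fun n x => ?_) hd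
    (fun x hx => ?_) y
  · rw [one_mul, _root_.smul_apply, norm_smul, Complex.norm_real, Real.norm_eq_abs]
    exact hb n x
  · rw [tendsto_iff_norm_sub_tendsto_zero]
    have h0 : Tendsto (fun n => |m n|⁻¹ * ‖L ⟨x, hx⟩‖) atTop (𝓝 0) := by
      simpa using (tendsto_inv_atTop_zero.comp hm).mul_const ‖L ⟨x, hx⟩‖
    refine squeeze_zero (fun _ => norm_nonneg _) (fun n => ?_) h0
    have h1 := hR' n ⟨x, hx⟩
    rw [map_sub, map_smul, sub_eq_iff_eq_add] at h1
    rw [_root_.smul_apply, h1, add_sub_cancel_left, inv_mul_eq_div,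
      le_div_iff₀ (abs_pos.2 (hm0 n)), mul_comm]
    exact hb n _

/-- **Stone's theorem**, existence part: a densely defined skew-symmetric operator for which
`μ - L` is onto for all large real `|μ|` generates a unitary group. -/
theorem exists_isUnitaryGroupOf {L : H →ₗ.[ℂ] H} (hd : Dense (L.domain : Set H))
    (hskew : ∀ x y : L.domain, ⟪L x, (y : H)⟫_ℂ = -⟪(x : H), L y⟫_ℂ) {μ₀ : ℝ} (hμ₀ : 0 < μ₀)
    (hsurj : ∀ μ : ℝ, μ₀ ≤ |μ| → ∀ y, ∃ x : L.domain, (μ : ℂ) • (x : H) - L x = y) :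
    ∃ U, IsUnitaryGroupOf L U := by
  let m : ℕ → ℝ := fun n => μ₀ + n
  have hmpos : ∀ n, 0 < m n := fun n => by positivity
  have hm : Tendsto m atTop atTop := tendsto_atTop_add_const_left _ _ tendsto_natCast_atTop_atTop
  have hle : ∀ n, μ₀ ≤ |m n| := fun n => by
    rw [abs_of_pos (hmpos n)]; exact le_add_of_nonneg_right n.cast_nonneg
  choose P hPb hP hP' using fun n =>
    exists_resolvent_of_skew hskew (hmpos n).ne' (hsurj (m n) (hle n))
  choose Q hQb hQ hQ' using fun n =>
    exists_resolvent_of_skew hskew (neg_ne_zero.2 (hmpos n).ne')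
      (hsurj (-m n) (by rw [abs_neg]; exact hle n))
  have hadj : ∀ n, star (P n) = -Q n := by
    intro n
    refine ((ContinuousLinearMap.eq_adjoint_iff (-Q n) (P n)).2 fun x y => ?_).symm
    obtain ⟨h1, e1⟩ := hQ n x
    obtain ⟨h2, e2⟩ := hP n y
    conv_rhs => rw [← e1]
    conv_lhs => rw [← e2]
    rw [_root_.neg_apply, inner_neg_left, inner_sub_left, inner_sub_right,
      inner_smul_left, inner_smul_right, hskew ⟨Q n x, h1⟩ ⟨P n y, h2⟩]
    simp only [Complex.ofReal_neg, map_neg, Complex.conj_ofReal]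
    ring
  have hadj' : ∀ n, star (Q n) = -P n := fun n => by
    rw [← star_star (P n), hadj, star_neg, neg_neg]
  -- With `P = (m - L)⁻¹` and `Q = (-m - L)⁻¹` this is formally `m² L / (m² - L²)`, which tends to
  -- `L`. Using both points `±m` makes it skew-adjoint, since `P* = -Q`.
  let K : ℕ → H →L[ℂ] H := fun n => ((m n ^ 2 / 2 : ℝ) : ℂ) • (P n + Q n)
  have hK : ∀ n, K n ∈ skewAdjoint (H →L[ℂ] H) := by
    intro n
    rw [skewAdjoint.mem_iff, star_smul, star_add, hadj, hadj', Complex.star_def,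
      Complex.conj_ofReal, ← smul_neg]
    congr 1
    abel
  have hc : ∀ i j, Commute (K i) (K j) := by
    intro i j
    refine ((Commute.add_left ?_ ?_).smul_left _).smul_right _ <;> refine Commute.add_right ?_ ?_
    · exact resolvent_mul_comm (hP i) (hP j) (hP' i) (hP' j)
    · exact resolvent_mul_comm (hP i) (hQ j) (hP' i) (hQ' j)
    · exact resolvent_mul_comm (hQ i) (hP j) (hQ' i) (hP' j)
    · exact resolvent_mul_comm (hQ i) (hQ j) (hQ' i) (hQ' j)
  have hKx : ∀ n (x : L.domain),
      K n x = (1 / 2 : ℂ) • ((m n : ℂ) • P n (L x) + ((-m n : ℝ) : ℂ) • Q n (L x)) := by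
    intro n x
    have h1 := hP' n x
    have h2 := hQ' n x
    rw [map_sub, map_smul, sub_eq_iff_eq_add] at h1 h2
    have h3 : P n (L x) = (m n : ℂ) • P n x - x := by rw [h1]; abel
    have h4 : Q n (L x) = ((-m n : ℝ) : ℂ) • Q n x - x := by rw [h2]; abel
    rw [h3, h4]
    change ((m n ^ 2 / 2 : ℝ) : ℂ) • (P n x + Q n x) = _
    push_cast
    module
  have hG : ∀ x (hx : x ∈ L.domain), Tendsto (fun n => K n x) atTop (𝓝 (L ⟨x, hx⟩)) := by
    intro x hx
    have h1 := tendsto_smul_resolvent hd (fun n => (hmpos n).ne')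
      (tendsto_abs_atTop_atTop.comp hm) hPb hP' (L ⟨x, hx⟩)
    have h2 := tendsto_smul_resolvent hd (m := fun n => -m n)
      (fun n => neg_ne_zero.2 (hmpos n).ne')
      (by simpa only [abs_neg, Function.comp_def] using tendsto_abs_atTop_atTop.comp hm) hQb hQ' (L ⟨x, hx⟩)
    have h3 := (h1.add h2).const_smul (1 / 2 : ℂ)
    rw [← two_smul ℂ (L ⟨x, hx⟩), smul_smul, one_div, inv_mul_cancel₀ two_ne_zero, one_smul] at h3
    refine h3.congr fun n => ?_
    rw [← one_div]
    exact (hKx n ⟨x, hx⟩).symm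
  classical
  let G : H → H := fun x => if hx : x ∈ L.domain then L ⟨x, hx⟩ else 0
  have hGx : ∀ x : L.domain, G x = L x := fun x => by simp [G]
  obtain ⟨U, hU0, hUadd, hUn, hUc, hUd⟩ := exists_unitaryGroup_of_tendsto hK hc hd (G := G)
    (fun x hx => by simpa only [hGx ⟨x, hx⟩] using hG x hx)
  refine ⟨U, hU0, hUadd, hUn, hUc, fun ψ φ => ?_⟩
  rw [LinearPMap.mem_graph_iff]
  constructor
  · rintro ⟨x, rfl, rfl⟩
    have := hUd x x.2
    rwa [hGx] at this
  · intro h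
    -- The generator is no larger than `L`: solving `(μ₀ - L) z = μ₀ ψ - φ` gives `φ - L z = μ₀ (ψ -
    -- z)`. As `‖U t (ψ - z)‖²` is constant, its derivative `2 μ₀ ‖ψ - z‖²` at 0 vanishes, so `ψ =
    -- z`.
    obtain ⟨z, hz⟩ := hsurj μ₀ (le_abs_self _) ((μ₀ : ℂ) • ψ - φ)
    have hz' : HasDerivAt (fun t => U t z) (L z) 0 := by
      have := hUd z z.2
      rwa [hGx] at this
    have hd := h.fun_sub hz'
    have e : φ - L z = (μ₀ : ℂ) • (ψ - z) := by
      rw [smul_sub, sub_eq_iff_eq_add, sub_add, hz]; abel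
    have hU0x : ∀ x, U 0 x = x := fun x => by rw [hU0]; rfl
    have hsq := (hd.inner ℂ hd).unique (by
      simpa only [← map_sub, inner_self_eq_norm_sq_to_K, hUn] using
        hasDerivAt_const (0 : ℝ) ((RCLike.ofReal ‖ψ - (z : H)‖ : ℂ) ^ 2))
    rw [hU0x, hU0x, e, inner_smul_right, inner_smul_left, inner_self_eq_norm_sq_to_K,
      Complex.conj_ofReal, ← two_mul] at hsq
    have h0 : ψ - z = 0 := by simpa [hμ₀.ne'] using hsq
    refine ⟨z, (sub_eq_zero.1 h0).symm, ?_⟩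
    rw [h0, smul_zero, sub_eq_zero] at e
    exact e.symm

theorem isUnitaryGroupOf_unitaryGroup {L : H →ₗ.[ℂ] H} (h : ∃ U, IsUnitaryGroupOf L U) :
    IsUnitaryGroupOf L (unitaryGroup L) := by
  rw [unitaryGroup, dif_pos h]
  exact h.choose_spec

namespace IsUnitaryGroupOf

variable {L : H →ₗ.[ℂ] H} {U : ℝ → H →L[ℂ] H}

theorem hasDerivAt (hU : IsUnitaryGroupOf L U) (x : L.domain) (t : ℝ) :
    HasDerivAt (fun s => U s x) (U t (L x)) t := by
  have h0 : HasDerivAt (fun s => U s x) (L x) 0 :=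
    (hU.generator _ _).1 ((LinearPMap.mem_graph_iff _).2 ⟨x, rfl, rfl⟩)
  have h1 : HasDerivAt (fun s => U (s - t) x) (L x) t :=
    HasDerivAt.comp_sub_const t t (by rwa [sub_self])
  have h2 := ((U t).restrictScalars ℝ).hasFDerivAt.comp_hasDerivAt t h1
  refine h2.congr_of_eventuallyEq (Eventually.of_forall fun s => ?_)
  change U s x = U t (U (s - t) x)
  rw [← mul_apply_eq_comp, ← hU.add, add_sub_cancel]

theorem mem_domain (hU : IsUnitaryGroupOf L U) (x : L.domain) (t : ℝ) :
    ∃ h : U t x ∈ L.domain, L ⟨U t x, h⟩ = U t (L x) := by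
  have h1 : HasDerivAt (fun s => U s (U t x)) (U t (L x)) 0 := by
    have h2 : HasDerivAt (fun s => U (s + t) x) (U t (L x)) 0 :=
      HasDerivAt.comp_add_const 0 t (by rw [zero_add]; exact hU.hasDerivAt x t)
    refine h2.congr_of_eventuallyEq (Eventually.of_forall fun s => ?_)
    change U s (U t x) = U (s + t) x
    rw [hU.add, mul_apply_eq_comp]
  obtain ⟨y, hy, hLy⟩ := (LinearPMap.mem_graph_iff _).1 ((hU.generator _ _).2 h1)
  have hy' : (y : H) = U t x := hy
  have hm : U t x ∈ L.domain := hy' ▸ y.2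
  refine ⟨hm, ?_⟩
  have e : y = ⟨U t x, hm⟩ := Subtype.ext hy'
  rw [← e]
  exact hLy

end IsUnitaryGroupOf

variable {A B : H →ₗ.[ℂ] H} {a b : ℝ} {Φ : HilbertBasis ℕ ℂ H} {lam : ℕ → ℝ}

theorem memℓp_two_of_norm_le {f g : ℕ → ℂ} {C : ℝ} (hg : Memℓp g 2)
    (h : ∀ k, ‖f k‖ ≤ C * ‖g k‖) : Memℓp f 2 := by
  have h2 : 0 < (2 : ℝ≥0∞).toReal := by norm_num
  refine (memℓp_gen_iff h2).2 (Summable.of_nonneg_of_le (fun k => by positivity) (fun k => ?_)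
    (((memℓp_gen_iff h2).1 hg).mul_left (C ^ (2 : ℝ≥0∞).toReal)))
  norm_num
  rw [← mul_pow]
  exact pow_le_pow_left₀ (norm_nonneg _) (h k) 2

theorem memℓp_two_coeff (Φ : HilbertBasis ℕ ℂ H) (x : H) : Memℓp (fun k => ⟪Φ k, x⟫_ℂ) 2 := by
  have e : (fun k => ⟪Φ k, x⟫_ℂ) = ⇑(Φ.repr x) := funext fun k => (Φ.repr_apply_apply x k).symm
  rw [e]
  exact lp.memℓp (Φ.repr x)

theorem exists_coeff_eq (Φ : HilbertBasis ℕ ℂ H) {f : ℕ → ℂ} (hf : Memℓp f 2) :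
    ∃ x : H, ∀ k, ⟪Φ k, x⟫_ℂ = f k :=
  ⟨Φ.repr.symm ⟨f, hf⟩, fun k => by rw [← Φ.repr_apply_apply, LinearIsometryEquiv.apply_symm_apply]⟩

/-! ### Generation by `A + cB`: diagonalisation of `A` and Kato–Rellich. -/

namespace KatoPair

theorem skew (hAB : KatoPair A B a b) (x y : A.domain) :
    ⟪A x, (y : H)⟫_ℂ = -⟪(x : H), A y⟫_ℂ := by
  have h := LinearPMap.adjoint_isFormalAdjoint hAB.dense_domain
  rw [hAB.skewAdjoint] at h
  have h1 := h x y
  rw [LinearPMap.neg_apply, inner_neg_left] at h1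
  rw [← h1, neg_neg]

/-- The weak relation places `x` in the domain of the adjoint, which is that of `A` because `A* =
-A`. -/
theorem mem_domain_of_inner (hAB : KatoPair A B a b) {x z : H}
    (h : ∀ y : A.domain, ⟪z, (y : H)⟫_ℂ = -⟪x, A y⟫_ℂ) : ∃ hx : x ∈ A.domain, A ⟨x, hx⟩ = z := by
  have h0 : ∀ y : A.domain, ⟪-z, (y : H)⟫_ℂ = ⟪x, A y⟫_ℂ := fun y => by
    rw [inner_neg_left, h, neg_neg]
  have h1 : x ∈ A.adjoint.domain := LinearPMap.mem_adjoint_domain_of_exists x ⟨-z, h0⟩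
  have h2 : x ∈ A.domain := by
    have h3 := h1
    rw [hAB.skewAdjoint] at h3
    exact h3
  refine ⟨h2, hAB.dense_domain.eq_of_inner_left ℂ fun y hy => ?_⟩
  rw [hAB.skew ⟨x, h2⟩ ⟨y, hy⟩, h ⟨y, hy⟩]

/-- The operator `B` restricted to the domain of `A`. -/
def pert (hAB : KatoPair A B a b) : A.domain →ₗ[ℂ] H :=
  B.toFun ∘ₗ Submodule.inclusion hAB.domain_le

theorem norm_pert_le (hAB : KatoPair A B a b) (x : A.domain) :
    ‖hAB.pert x‖ ≤ a * ‖A x‖ + b * ‖(x : H)‖ :=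
  hAB.relBound x x.2 (hAB.domain_le x.2)

theorem pert_skew (hAB : KatoPair A B a b) (x y : A.domain) :
    ⟪hAB.pert x, (y : H)⟫_ℂ = -⟪(x : H), hAB.pert y⟫_ℂ :=
  hAB.skewSymmetric ⟨x, hAB.domain_le x.2⟩ ⟨y, hAB.domain_le y.2⟩

theorem mem_add_smul_domain (hAB : KatoPair A B a b) (c : ℝ) {x : H} :
    x ∈ (A + (c : ℂ) • B).domain ↔ x ∈ A.domain :=
  ⟨fun h => h.1, fun h => ⟨h, hAB.domain_le h⟩⟩

theorem add_smul_apply (hAB : KatoPair A B a b) (c : ℝ) {x : H} (hx : x ∈ A.domain)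
    (hx' : x ∈ (A + (c : ℂ) • B).domain) :
    (A + (c : ℂ) • B) ⟨x, hx'⟩ = A ⟨x, hx⟩ + (c : ℂ) • hAB.pert ⟨x, hx⟩ := rfl

theorem add_smul_skew (hAB : KatoPair A B a b) (c : ℝ) (x y : (A + (c : ℂ) • B).domain) :
    ⟪(A + (c : ℂ) • B) x, (y : H)⟫_ℂ = -⟪(x : H), (A + (c : ℂ) • B) y⟫_ℂ := by
  have e1 := hAB.add_smul_apply c x.2.1 x.2
  have e2 := hAB.add_smul_apply c y.2.1 y.2
  have h1 := hAB.skew ⟨x, x.2.1⟩ ⟨y, y.2.1⟩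
  have h2 := hAB.pert_skew ⟨x, x.2.1⟩ ⟨y, y.2.1⟩
  rw [e1, e2, inner_add_left, inner_add_right, inner_smul_left, inner_smul_right,
    Complex.conj_ofReal, h1, h2]
  ring

theorem inner_basis (hAB : KatoPair A B a b) (hΦ : IsDiagonalIn A Φ lam) (x : A.domain) (k : ℕ) :
    ⟪Φ k, A x⟫_ℂ = -Complex.I * lam k * ⟪Φ k, (x : H)⟫_ℂ := by
  have h := hAB.skew ⟨Φ k, hΦ.mem_domain k⟩ x
  rw [hΦ.eigen, inner_smul_left] at h
  rw [← neg_eq_iff_eq_neg.2 h]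
  simp

/-- Parseval turns the relation between coefficients into the weak relation of
`mem_domain_of_inner`. -/
theorem mem_domain_of_coeff (hAB : KatoPair A B a b) (hΦ : IsDiagonalIn A Φ lam) {x z : H}
    (h : ∀ k, ⟪Φ k, z⟫_ℂ = -Complex.I * lam k * ⟪Φ k, x⟫_ℂ) :
    ∃ hx : x ∈ A.domain, A ⟨x, hx⟩ = z := by
  refine hAB.mem_domain_of_inner fun y => ?_
  refine (Φ.hasSum_inner_mul_inner z (y : H)).unique ?_
  refine (Φ.hasSum_inner_mul_inner x (A y)).neg.congr_fun ?_
  intro k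
  rw [hAB.inner_basis hΦ, ← inner_conj_symm z, ← inner_conj_symm x, h]
  simp
  ring

/-- Solved coefficientwise: `μ - A` acts by `μ + iλ_k`, of modulus at least `|μ|`. -/
theorem exists_smul_sub_eq (hAB : KatoPair A B a b) (hΦ : IsDiagonalIn A Φ lam) {μ : ℝ}
    (hμ : μ ≠ 0) (y : H) : ∃ x : A.domain, (μ : ℂ) • (x : H) - A x = y := by
  have hre : ∀ k, |μ| ≤ ‖(μ : ℂ) + Complex.I * lam k‖ := fun k => by
    simpa using Complex.abs_re_le_norm ((μ : ℂ) + Complex.I * lam k)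
  have hne : ∀ k, (μ : ℂ) + Complex.I * lam k ≠ 0 := fun k h => by
    have := hre k
    rw [h, norm_zero] at this
    exact absurd this (not_le.2 (abs_pos.2 hμ))
  obtain ⟨x, hx⟩ := exists_coeff_eq Φ
    (f := fun k => ⟪Φ k, y⟫_ℂ / ((μ : ℂ) + Complex.I * lam k))
    (memℓp_two_of_norm_le (C := |μ|⁻¹) (memℓp_two_coeff Φ y) fun k => by
      rw [norm_div, div_eq_inv_mul]
      exact mul_le_mul_of_nonneg_right (inv_anti₀ (abs_pos.2 hμ) (hre k)) (norm_nonneg _))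
  obtain ⟨h, e⟩ := hAB.mem_domain_of_coeff hΦ (x := x) (z := (μ : ℂ) • x - y) fun k => by
    have := hne k
    rw [inner_sub_right, inner_smul_right, hx]
    field_simp
    ring
  exact ⟨⟨x, h⟩, by rw [e, sub_sub_cancel]⟩

/-- The cross term is imaginary. Consequently `‖A (μ - A)⁻¹‖ ≤ 1`, so no constant is lost on the
relative bound `a`. -/
theorem norm_smul_sub_sq (hAB : KatoPair A B a b) (μ : ℝ) (x : A.domain) :
    ‖(μ : ℂ) • (x : H) - A x‖ ^ 2 = μ ^ 2 * ‖(x : H)‖ ^ 2 + ‖A x‖ ^ 2 := by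
  rw [@norm_sub_sq ℂ, inner_smul_left, Complex.conj_ofReal]
  have h := inner_eq_re_zero_of_skew hAB.skew x
  have e : RCLike.re ((μ : ℂ) * ⟪(x : H), A x⟫_ℂ) = μ * (⟪(x : H), A x⟫_ℂ).re := by simp
  rw [e, h, norm_smul, Complex.norm_real, mul_pow, Real.norm_eq_abs, sq_abs]
  ring

/-- The Kato–Rellich perturbation argument: `μ - (A + cB)` is onto for large `|μ|`. -/
theorem exists_smul_sub_add_smul_eq (hAB : KatoPair A B a b) (hΦ : IsDiagonalIn A Φ lam) {c : ℝ}
    {μ : ℝ} (hμ : μ ≠ 0) (hc : |c| * (a + b * |μ|⁻¹) < 1) (y : H) :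
    ∃ x : (A + (c : ℂ) • B).domain, (μ : ℂ) • (x : H) - (A + (c : ℂ) • B) x = y := by
  obtain ⟨R, hRb, hR, -⟩ := exists_resolvent_of_skew hAB.skew hμ (hAB.exists_smul_sub_eq hΦ hμ)
  have hRm : ∀ y, R y ∈ A.domain := fun y => (hR y).1
  have hRe : ∀ y, (μ : ℂ) • R y - A ⟨R y, hRm y⟩ = y := fun y => (hR y).2
  have hRA : ∀ y, ‖A ⟨R y, hRm y⟩‖ ≤ ‖y‖ := fun y => by
    have h := hAB.norm_smul_sub_sq μ ⟨R y, hRm y⟩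
    rw [hRe] at h
    refine le_of_sq_le_sq ?_ (norm_nonneg _)
    rw [h]
    exact le_add_of_nonneg_left (by positivity)
  -- `T = cB(μ - A)⁻¹`, so that `μ - (A + cB) = (1 - T)(μ - A)` and `1 - T` is inverted by a Neumann
  -- series.
  let T₀ : H →ₗ[ℂ] H := (c : ℂ) • hAB.pert ∘ₗ (R : H →ₗ[ℂ] H).codRestrict A.domain hRm
  have hT₀ : ∀ y, T₀ y = (c : ℂ) • hAB.pert ⟨R y, hRm y⟩ := fun y => rfl
  let T : H →L[ℂ] H := T₀.mkContinuous (|c| * (a + b * |μ|⁻¹)) fun y => by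
    rw [hT₀, norm_smul, Complex.norm_real, Real.norm_eq_abs, mul_assoc]
    refine mul_le_mul_of_nonneg_left ((hAB.norm_pert_le _).trans ?_) (abs_nonneg c)
    have h1 : ‖R y‖ ≤ |μ|⁻¹ * ‖y‖ := by
      rw [inv_mul_eq_div, le_div_iff₀ (abs_pos.2 hμ), mul_comm]
      exact hRb y
    have h2 := mul_le_mul_of_nonneg_left (hRA y) hAB.a_nonneg
    have h3 := mul_le_mul_of_nonneg_left h1 hAB.b_nonneg
    change a * ‖A ⟨R y, hRm y⟩‖ + b * ‖R y‖ ≤ _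
    linarith
  have hT : ‖T‖ < 1 := by
    refine (LinearMap.mkContinuous_norm_le _ ?_ _).trans_lt hc
    have := hAB.a_nonneg
    have := hAB.b_nonneg
    positivity
  obtain ⟨z, hz⟩ := (ContinuousLinearMap.isUnit_iff_bijective.1
    (isUnit_one_sub_of_norm_lt_one hT)).2 y
  refine ⟨⟨R z, (hAB.mem_add_smul_domain c).2 (hRm z)⟩, ?_⟩
  rw [hAB.add_smul_apply c (hRm z), ← sub_sub, hRe, ← hz]
  rfl

theorem isUnitaryGroupOf (hAB : KatoPair A B a b) (hΦ : IsDiagonalIn A Φ lam) {c : ℝ}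
    (hc : |c| * a < 1) :
    IsUnitaryGroupOf (A + (c : ℂ) • B) (unitaryGroup (A + (c : ℂ) • B)) := by
  refine isUnitaryGroupOf_unitaryGroup ?_
  have hb := hAB.b_nonneg
  have hcb : 0 ≤ |c| * b := by positivity
  have hd : 0 < 1 - |c| * a := by linarith
  -- Beyond this threshold `|c|(a + b/|μ|) < 1`; the `+ 1` makes the inequality strict and the
  -- threshold positive.
  have hμ₀ : 0 < (|c| * b + 1) / (1 - |c| * a) := by positivity
  refine exists_isUnitaryGroupOf ?_ (hAB.add_smul_skew c) hμ₀ fun μ hμ y => ?_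
  · have e : ((A + (c : ℂ) • B).domain : Set H) = A.domain :=
      Set.ext fun x => hAB.mem_add_smul_domain c
    rw [e]
    exact hAB.dense_domain
  · have hμ' : 0 < |μ| := hμ₀.trans_le hμ
    refine hAB.exists_smul_sub_add_smul_eq hΦ (abs_pos.1 hμ') ?_ y
    rw [div_le_iff₀ hd] at hμ
    have h1 : |c| * b * |μ|⁻¹ < 1 - |c| * a := by
      rw [← div_eq_mul_inv, div_lt_iff₀ hμ']
      linarith
    linarith

end KatoPair

/-- Along the group generated by `A + cB`, the domain of `A` is invariant and the value of
`A + cB` is transported. -/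
theorem KatoPair.unitaryGroup_mem (hAB : KatoPair A B a b) (hΦ : IsDiagonalIn A Φ lam) {c : ℝ}
    (hc : |c| * a < 1) (x : A.domain) (t : ℝ) :
    ∃ y : A.domain, (y : H) = unitaryGroup (A + (c : ℂ) • B) t x ∧
      A y + (c : ℂ) • hAB.pert y
        = unitaryGroup (A + (c : ℂ) • B) t (A x + (c : ℂ) • hAB.pert x) := by
  obtain ⟨h, e⟩ := (hAB.isUnitaryGroupOf hΦ hc).mem_domain
    ⟨x, (hAB.mem_add_smul_domain c).2 x.2⟩ t
  exact ⟨⟨_, (hAB.mem_add_smul_domain c).1 h⟩, rfl, e⟩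

/-! ### Energies and their behaviour when the control value changes. -/

namespace KatoPair

/-- The graph norm of `A + cB`, weighted so that it controls `B` optimally. -/
def energy (hAB : KatoPair A B a b) (c : ℝ) (x : A.domain) : ℝ :=
  ‖A x + (c : ℂ) • hAB.pert x‖ + b / a * ‖(x : H)‖

/-- The norm of `(A + cB - i) x`. For `A` diagonal with eigenvalues `-iλ_k` and `c = 0`, the
coefficients of this vector have modulus `|1 + λ_k| |x_k|`. -/
def shiftedEnergy (hAB : KatoPair A B a b) (c : ℝ) (x : A.domain) : ℝ :=
  ‖A x + (c : ℂ) • hAB.pert x - Complex.I • (x : H)‖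

theorem energy_nonneg (hAB : KatoPair A B a b) (c : ℝ) (x : A.domain) : 0 ≤ hAB.energy c x := by
  have := hAB.a_nonneg
  have := hAB.b_nonneg
  unfold energy
  positivity

/-- From `a‖Ax‖ ≤ a‖(A + cB)x‖ + |c| a ‖Bx‖` and `|c| a ≤ 1 - δ`, the term in `‖Bx‖` is absorbed on
the left, leaving `δ‖Bx‖`. -/
theorem norm_pert_le_energy (hAB : KatoPair A B a b) (ha : 0 < a) {δ c : ℝ} (hδ : 0 < δ)
    (hc : |c| ≤ (1 - δ) / a) (x : A.domain) : ‖hAB.pert x‖ ≤ a / δ * hAB.energy c x := by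
  have h1 := hAB.norm_pert_le x
  have h2 : ‖A x‖ ≤ ‖A x + (c : ℂ) • hAB.pert x‖ + |c| * ‖hAB.pert x‖ := by
    have h := norm_sub_le (A x + (c : ℂ) • hAB.pert x) ((c : ℂ) • hAB.pert x)
    rwa [add_sub_cancel_right, norm_smul, Complex.norm_real, Real.norm_eq_abs] at h
  have h3 : |c| * a ≤ 1 - δ := (le_div_iff₀ ha).1 hc
  have h4 := mul_le_mul_of_nonneg_right h3 (norm_nonneg (hAB.pert x))
  have h5 := mul_le_mul_of_nonneg_left h2 ha.le
  have e : a / δ * hAB.energy c x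
      = (a * ‖A x + (c : ℂ) • hAB.pert x‖ + b * ‖(x : H)‖) / δ := by
    unfold energy
    field_simp
  rw [e, le_div_iff₀ hδ]
  linarith

theorem energy_le (hAB : KatoPair A B a b) (ha : 0 < a) {δ c : ℝ} (hδ : 0 < δ)
    (hc : |c| ≤ (1 - δ) / a) (c' : ℝ) (x : A.domain) :
    hAB.energy c' x ≤ (1 + a / δ * |c' - c|) * hAB.energy c x := by
  have h1 := mul_le_mul_of_nonneg_left (hAB.norm_pert_le_energy ha hδ hc x) (abs_nonneg (c' - c))
  have e : A x + (c' : ℂ) • hAB.pert x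
      = (A x + (c : ℂ) • hAB.pert x) + ((c' - c : ℝ) : ℂ) • hAB.pert x := by
    push_cast; module
  have h2 := norm_add_le (A x + (c : ℂ) • hAB.pert x) (((c' - c : ℝ) : ℂ) • hAB.pert x)
  rw [← e, norm_smul, Complex.norm_real, Real.norm_eq_abs] at h2
  have h3 : hAB.energy c' x ≤ hAB.energy c x + |c' - c| * ‖hAB.pert x‖ := by
    unfold energy
    linarith
  linarith

/-- The error is measured by the energy, because the shifted energy can vanish on a nonzero vector
(at `c = 0`, an eigenvector with `λ = -1`). -/
theorem shiftedEnergy_le (hAB : KatoPair A B a b) (ha : 0 < a) {δ c : ℝ} (hδ : 0 < δ)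
    (hc : |c| ≤ (1 - δ) / a) (c' : ℝ) (x : A.domain) :
    hAB.shiftedEnergy c' x ≤ hAB.shiftedEnergy c x + a / δ * |c' - c| * hAB.energy c x := by
  have h1 := mul_le_mul_of_nonneg_left (hAB.norm_pert_le_energy ha hδ hc x) (abs_nonneg (c' - c))
  have e : A x + (c' : ℂ) • hAB.pert x - Complex.I • (x : H)
      = (A x + (c : ℂ) • hAB.pert x - Complex.I • (x : H))
        + ((c' - c : ℝ) : ℂ) • hAB.pert x := by
    push_cast; module
  have h2 := norm_add_le (A x + (c : ℂ) • hAB.pert x - Complex.I • (x : H))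
    (((c' - c : ℝ) : ℂ) • hAB.pert x)
  rw [← e, norm_smul, Complex.norm_real, Real.norm_eq_abs] at h2
  unfold shiftedEnergy
  linarith

/-- Energy growth measured at `c` transfers to energy growth measured at `c'`. -/
theorem energy_growth_change (hAB : KatoPair A B a b) (ha : 0 < a) {δ c c' : ℝ} (hδ : 0 < δ)
    (hc : |c| ≤ (1 - δ) / a) (hc' : |c'| ≤ (1 - δ) / a) {J : ℝ} (hJ : 0 ≤ J)
    {x y : A.domain}
    (hM : hAB.energy c y ≤ Real.exp (2 * (a / δ) * J) * hAB.energy c x)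
    (hG : hAB.shiftedEnergy c y
      ≤ hAB.shiftedEnergy c x + (Real.exp (2 * (a / δ) * J) - 1) * hAB.energy c x) :
    hAB.energy c' y ≤ Real.exp (2 * (a / δ) * (|c - c'| + J)) * hAB.energy c' x ∧
      hAB.shiftedEnergy c' y ≤ hAB.shiftedEnergy c' x
        + (Real.exp (2 * (a / δ) * (|c - c'| + J)) - 1) * hAB.energy c' x := by
  -- One change of value costs `1 + s ≤ q = e^s`. It is paid on `x` (from `c'` to `c`) and again on
  -- `y` (back to `c'`), whence `q * q`.
  set s := a / δ * |c - c'| with hs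
  set E := Real.exp (2 * (a / δ) * J) with hE
  set q := Real.exp s with hq
  have hs0 : 0 ≤ s := by positivity
  have hE0 : 0 < E := Real.exp_pos _
  have h1q : 1 + s ≤ q := by rw [add_comm]; exact Real.add_one_le_exp s
  have hq0 : 0 < q := Real.exp_pos _
  have eE : Real.exp (2 * (a / δ) * (|c - c'| + J)) = q * q * E := by
    rw [hq, hE, ← Real.exp_add, ← Real.exp_add, hs]
    ring_nf
  have hM0 := hAB.energy_nonneg c' x
  have hMx := hAB.energy_le ha hδ hc' c x
  rw [← hs] at hMx
  have hMy := hAB.energy_le ha hδ hc c' y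
  have hGx := hAB.shiftedEnergy_le ha hδ hc' c x
  rw [← hs] at hGx
  have hGy := hAB.shiftedEnergy_le ha hδ hc c' y
  rw [abs_sub_comm, ← hs] at hMy hGy
  rw [eE]
  have hMx' : hAB.energy c x ≤ q * hAB.energy c' x :=
    hMx.trans (mul_le_mul_of_nonneg_right h1q hM0)
  have hMy' : hAB.energy c y ≤ E * (q * hAB.energy c' x) :=
    hM.trans (mul_le_mul_of_nonneg_left hMx' hE0.le)
  constructor
  · calc hAB.energy c' y ≤ (1 + s) * hAB.energy c y := hMy
      _ ≤ q * (E * (q * hAB.energy c' x)) :=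
        mul_le_mul h1q hMy' (hAB.energy_nonneg _ _) hq0.le
      _ = q * q * E * hAB.energy c' x := by ring
  · have hE1 : 1 ≤ E := Real.one_le_exp (by positivity)
    have hfac : 0 ≤ (1 + s) * E - 1 := by
      have := mul_nonneg hs0 hE0.le
      linarith
    have h1 := mul_le_mul_of_nonneg_left hM hs0
    have h2 := mul_le_mul_of_nonneg_left hMx' hfac
    -- The first `s` is the cost of moving `x` to `c`; the rest is the growth at `c` and the return
    -- on `y`, with `M_c(x) ≤ q M_{c'}(x)`. The inequality uses `1 + s ≤ q` twice.
    have h3 : (s + ((1 + s) * E - 1) * q) * hAB.energy c' x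
        ≤ (q * q * E - 1) * hAB.energy c' x := by
      refine mul_le_mul_of_nonneg_right ?_ hM0
      have h4 := mul_le_mul_of_nonneg_right h1q (mul_nonneg hE0.le hq0.le)
      linarith
    linarith

end KatoPair

/-! ### Jumps, total variation and bounds of step controls. -/

/-- The sum of the jumps of a piecewise constant control, the initial value being `c₀`. -/
def jumpSum (c : ℝ) : ℝ → List (Set.Ioi (0 : ℝ) × ℝ) → ℝ
  | c₀, [] => |c - c₀|
  | c₀, (_, d) :: l => |d - c₀| + jumpSum c d l

theorem jumpSum_nonneg (c c₀ : ℝ) (l : List (Set.Ioi (0 : ℝ) × ℝ)) : 0 ≤ jumpSum c c₀ l := by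
  induction l generalizing c₀ with
  | nil => exact abs_nonneg _
  | cons p l ih => exact add_nonneg (abs_nonneg _) (ih _)

theorem stepValue_of_nonpos (c : ℝ) (l : List (Set.Ioi (0 : ℝ) × ℝ)) {t : ℝ} (ht : t ≤ 0) :
    stepValue c l t = 0 := by
  rcases l with _ | ⟨p, l⟩ <;> simp [stepValue, ht]

theorem stepValue_cons_add (c : ℝ) (τ : Set.Ioi (0 : ℝ)) (d : ℝ)
    (l : List (Set.Ioi (0 : ℝ) × ℝ)) {t : ℝ} (ht : 0 < t) :
    stepValue c ((τ, d) :: l) (t + τ) = stepValue c l t := by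
  have hτ : (0 : ℝ) < τ := τ.2
  rw [stepValue, if_neg (by linarith), if_neg (by linarith), add_sub_cancel_right]

theorem stepValue_cons_self (c : ℝ) (τ : Set.Ioi (0 : ℝ)) (d : ℝ)
    (l : List (Set.Ioi (0 : ℝ) × ℝ)) : stepValue c ((τ, d) :: l) τ = d := by
  rw [stepValue, if_neg (not_le.2 τ.2), if_pos le_rfl]

/-- A free value `c₀` on `t ≤ 0` makes the induction close: translated by `τ`, the part after the
first piece is the same problem with initial value `d`, and variation is superadditive across `τ`.
-/
theorem ofReal_jumpSum_le (c c₀ : ℝ) (l : List (Set.Ioi (0 : ℝ) × ℝ)) :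
    ENNReal.ofReal (jumpSum c c₀ l)
      ≤ eVariationOn (fun t => if t ≤ 0 then c₀ else stepValue c l t) (Set.Ici 0) := by
  induction l generalizing c₀ with
  | nil =>
    set f : ℝ → ℝ := fun t => if t ≤ 0 then c₀ else stepValue c [] t with hf
    have hf0 : f 0 = c₀ := if_pos le_rfl
    have hf1 : f 1 = c := by
      simp only [hf, stepValue, if_neg (not_le.2 (one_pos : (0 : ℝ) < 1))]
    have h := eVariationOn.edist_le f (s := Set.Ici 0) (x := 1) (y := 0)
      (Set.mem_Ici.2 zero_le_one) (Set.mem_Ici.2 le_rfl)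
    rwa [hf0, hf1, edist_dist, Real.dist_eq] at h
  | cons p l ih =>
    obtain ⟨τ, d⟩ := p
    have hτ : (0 : ℝ) < τ := τ.2
    set f : ℝ → ℝ := fun t => if t ≤ 0 then c₀ else stepValue c ((τ, d) :: l) t with hf
    have hf0 : f 0 = c₀ := by simp [hf]
    have hfτ : f τ = d := by
      rw [hf]
      simp only [stepValue_cons_self, if_neg (not_le.2 hτ)]
    have h1 : ENNReal.ofReal |d - c₀| ≤ eVariationOn f (Set.Icc 0 (τ : ℝ)) := by
      have h := eVariationOn.edist_le f (s := Set.Icc 0 (τ : ℝ)) (x := (τ : ℝ)) (y := 0)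
        (Set.right_mem_Icc.2 hτ.le) (Set.left_mem_Icc.2 hτ.le)
      rwa [hf0, hfτ, edist_dist, Real.dist_eq] at h
    have h2 : eVariationOn (fun t => if t ≤ 0 then d else stepValue c l t) (Set.Ici 0)
        ≤ eVariationOn f (Set.Ici (τ : ℝ)) := by
      have e : Set.EqOn (fun t => if t ≤ 0 then d else stepValue c l t)
          (f ∘ fun t => t + (τ : ℝ)) (Set.Ici 0) := by
        intro t ht
        rcases (Set.mem_Ici.1 ht).eq_or_lt with rfl | ht
        · simp [hfτ]
        · simp only [Function.comp, hf, if_neg (not_le.2 ht),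
            if_neg (not_le.2 (add_pos ht hτ)), stepValue_cons_add c τ d l ht]
      rw [eVariationOn.congr e]
      refine eVariationOn.comp_le_of_monotoneOn f _ (fun x _ y _ h => by simpa using h) ?_
      intro t ht
      simpa using ht
    have h3 := eVariationOn.add_le_union f (s := Set.Icc 0 (τ : ℝ)) (t := Set.Ici (τ : ℝ))
      (fun x hx y hy => hx.2.trans hy)
    rw [jumpSum, ENNReal.ofReal_add (abs_nonneg _) (jumpSum_nonneg _ _ _)]
    refine (add_le_add h1 ((ih d).trans h2)).trans (h3.trans (eVariationOn.mono f ?_))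
    intro t ht
    rcases ht with ht | ht
    · exact ht.1
    · exact hτ.le.trans ht

theorem jumpSum_le_totalVariation {δ a : ℝ} {v : StepControl} (hv : v.toFun ∈ admissible δ a) :
    jumpSum v.last 0 v.pieces ≤ totalVariation v.toFun := by
  have e : (fun t => if t ≤ 0 then 0 else stepValue v.last v.pieces t) = v.toFun := by
    funext t
    rw [StepControl.toFun]
    split_ifs with h
    · exact (stepValue_of_nonpos _ _ h).symm
    · rfl
  have h := ofReal_jumpSum_le v.last 0 v.pieces
  rw [e] at h
  exact (ENNReal.ofReal_le_iff_le_toReal hv.1).1 (h.trans (eVariationOn.mono _ (Set.subset_univ _)))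

/-- All the values of a piecewise constant control, including `c`, satisfy `|·| ≤ m`. -/
def StepBounded (m c : ℝ) (l : List (Set.Ioi (0 : ℝ) × ℝ)) : Prop :=
  |c| ≤ m ∧ ∀ p ∈ l, |p.2| ≤ m

theorem StepBounded.tail {m c : ℝ} {p : Set.Ioi (0 : ℝ) × ℝ} {l : List (Set.Ioi (0 : ℝ) × ℝ)}
    (h : StepBounded m c (p :: l)) : StepBounded m c l :=
  ⟨h.1, fun q hq => h.2 q (List.mem_cons_of_mem _ hq)⟩

theorem StepBounded.head {m c : ℝ} {p : Set.Ioi (0 : ℝ) × ℝ} {l : List (Set.Ioi (0 : ℝ) × ℝ)}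
    (h : StepBounded m c (p :: l)) : |p.2| ≤ m :=
  h.2 p List.mem_cons_self

theorem stepBounded_of_stepValue {m c : ℝ} {l : List (Set.Ioi (0 : ℝ) × ℝ)}
    (h : ∀ t > 0, |stepValue c l t| ≤ m) : StepBounded m c l := by
  induction l with
  | nil =>
    have h1 := h 1 one_pos
    rw [stepValue, if_neg (not_le.2 one_pos)] at h1
    exact ⟨h1, by simp⟩
  | cons p l ih =>
    obtain ⟨τ, d⟩ := p
    have hd := h τ τ.2
    rw [stepValue_cons_self] at hd
    have hl := ih fun t ht => by
      rw [← stepValue_cons_add c τ d l ht]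
      exact h _ (add_pos ht τ.2)
    refine ⟨hl.1, fun q hq => ?_⟩
    rcases List.mem_cons.1 hq with rfl | hq
    · exact hd
    · exact hl.2 q hq

theorem stepBounded_of_admissible {δ a : ℝ} {v : StepControl} (hv : v.toFun ∈ admissible δ a) :
    StepBounded ((1 - δ) / a) v.last v.pieces :=
  stepBounded_of_stepValue fun t _ => abs_le.2 ⟨(hv.2.2 t).1.le, (hv.2.2 t).2.le⟩

theorem abs_mul_lt_one {δ a c : ℝ} (ha : 0 < a) (hδ : 0 < δ) (hc : |c| ≤ (1 - δ) / a) :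
    |c| * a < 1 := by
  have := (le_div_iff₀ ha).1 hc
  linarith

/-! ### Flows of step controls: energy growth, isometry, continuity. -/

namespace KatoPair

theorem unitaryGroup_energy (hAB : KatoPair A B a b) (hΦ : IsDiagonalIn A Φ lam) {c : ℝ}
    (hc : |c| * a < 1) (x : A.domain) (t : ℝ) :
    ∃ y : A.domain, (y : H) = unitaryGroup (A + (c : ℂ) • B) t x ∧
      hAB.energy c y = hAB.energy c x ∧ hAB.shiftedEnergy c y = hAB.shiftedEnergy c x := by
  have hU := hAB.isUnitaryGroupOf hΦ hc
  obtain ⟨y, hy, e⟩ := hAB.unitaryGroup_mem hΦ hc x t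
  refine ⟨y, hy, ?_, ?_⟩
  · rw [energy, energy, e, hy, hU.norm_map, hU.norm_map]
  · rw [shiftedEnergy, shiftedEnergy, e, hy, ← (unitaryGroup (A + (c : ℂ) • B) t).map_smul Complex.I,
      ← map_sub, hU.norm_map]

/-- The domain of `A` is invariant under the flow of a piecewise constant control, with energy
growth bounded in terms of the jumps of the control. -/
theorem stepFlow_energy (hAB : KatoPair A B a b) (hΦ : IsDiagonalIn A Φ lam) (ha : 0 < a) {δ : ℝ}
    (hδ : 0 < δ) {c c₀ : ℝ} (hc₀ : |c₀| ≤ (1 - δ) / a) {l : List (Set.Ioi (0 : ℝ) × ℝ)}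
    (hl : StepBounded ((1 - δ) / a) c l) (t : ℝ) (x : A.domain) :
    ∃ y : A.domain, (y : H) = stepFlow A B c l t x ∧
      hAB.energy c₀ y ≤ Real.exp (2 * (a / δ) * jumpSum c c₀ l) * hAB.energy c₀ x ∧
      hAB.shiftedEnergy c₀ y ≤ hAB.shiftedEnergy c₀ x
        + (Real.exp (2 * (a / δ) * jumpSum c c₀ l) - 1) * hAB.energy c₀ x := by
  induction l generalizing c₀ t x with
  | nil =>
    obtain ⟨y, hy, e1, e2⟩ := hAB.unitaryGroup_energy hΦ (abs_mul_lt_one ha hδ hl.1) x t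
    refine ⟨y, hy, ?_⟩
    have h := hAB.energy_growth_change ha hδ hl.1 hc₀ le_rfl (x := x) (y := y)
      (by simp [e1]) (by simp [e2])
    rwa [add_zero] at h
  | cons p l ih =>
    obtain ⟨τ, d⟩ := p
    have hd : |d| ≤ (1 - δ) / a := hl.head
    have hJ := jumpSum_nonneg c d l
    have hE : 1 ≤ Real.exp (2 * (a / δ) * jumpSum c d l) := Real.one_le_exp (by positivity)
    have hgroup := hAB.unitaryGroup_energy hΦ (abs_mul_lt_one ha hδ hd) x
    by_cases htτ : t ≤ τ
    -- Within the first piece the later jumps have not occurred; their factor is at least 1 and is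
    -- simply thrown in.
    · obtain ⟨y, hy, e1, e2⟩ := hgroup t
      refine ⟨y, by rw [hy, stepFlow, if_pos htτ], ?_⟩
      have hM := hAB.energy_nonneg d x
      refine hAB.energy_growth_change ha hδ hd hc₀ hJ ?_ ?_
      · rw [e1]
        exact le_mul_of_one_le_left hM hE
      · rw [e2]
        exact le_add_of_nonneg_right (mul_nonneg (sub_nonneg.2 hE) hM)
    -- The remaining flow is measured at `d`, where the first group conserves both energies; only
    -- then is the estimate transferred to `c₀`.
    · obtain ⟨z, hz, e1, e2⟩ := hgroup τ
      obtain ⟨y, hy, h1, h2⟩ := ih hd hl.tail (t - τ) z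
      refine ⟨y, by rw [hy, stepFlow, if_neg htτ, hz, mul_apply_eq_comp], ?_⟩
      rw [e1] at h1
      rw [e1, e2] at h2
      exact hAB.energy_growth_change ha hδ hd hc₀ hJ h1 h2

theorem norm_stepFlow (hAB : KatoPair A B a b) (hΦ : IsDiagonalIn A Φ lam) (ha : 0 < a) {δ : ℝ}
    (hδ : 0 < δ) {c : ℝ} {l : List (Set.Ioi (0 : ℝ) × ℝ)}
    (hl : StepBounded ((1 - δ) / a) c l) (t : ℝ) (x : H) : ‖stepFlow A B c l t x‖ = ‖x‖ := by
  induction l generalizing t x with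
  | nil => exact (hAB.isUnitaryGroupOf hΦ (abs_mul_lt_one ha hδ hl.1)).norm_map t x
  | cons p l ih =>
    obtain ⟨τ, d⟩ := p
    have hU := hAB.isUnitaryGroupOf hΦ (abs_mul_lt_one ha hδ hl.head)
    rw [stepFlow]
    split_ifs with h
    · exact hU.norm_map t x
    · rw [mul_apply_eq_comp, ih hl.tail, hU.norm_map]

theorem stepFlow_zero (hAB : KatoPair A B a b) (hΦ : IsDiagonalIn A Φ lam) (ha : 0 < a) {δ : ℝ}
    (hδ : 0 < δ) {c : ℝ} {l : List (Set.Ioi (0 : ℝ) × ℝ)}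
    (hl : StepBounded ((1 - δ) / a) c l) : stepFlow A B c l 0 = 1 := by
  rcases l with _ | ⟨⟨τ, d⟩, l⟩
  · exact (hAB.isUnitaryGroupOf hΦ (abs_mul_lt_one ha hδ hl.1)).zero
  · rw [stepFlow, if_pos (le_of_lt τ.2)]
    exact (hAB.isUnitaryGroupOf hΦ (abs_mul_lt_one ha hδ hl.head)).zero

theorem stepFlow_cons_of_le (hAB : KatoPair A B a b) (hΦ : IsDiagonalIn A Φ lam) (ha : 0 < a)
    {δ : ℝ} (hδ : 0 < δ) {c d : ℝ} {τ : Set.Ioi (0 : ℝ)} {l : List (Set.Ioi (0 : ℝ) × ℝ)}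
    (hl : StepBounded ((1 - δ) / a) c ((τ, d) :: l)) {t : ℝ} (ht : (τ : ℝ) ≤ t) :
    stepFlow A B c ((τ, d) :: l) t
      = stepFlow A B c l (t - τ) * unitaryGroup (A + (d : ℂ) • B) τ := by
  rcases ht.eq_or_lt with rfl | ht
  · rw [stepFlow, if_pos le_rfl, sub_self, hAB.stepFlow_zero hΦ ha hδ hl.tail, one_mul]
  · rw [stepFlow, if_neg (not_le.2 ht)]

theorem continuousOn_stepFlow (hAB : KatoPair A B a b) (hΦ : IsDiagonalIn A Φ lam) (ha : 0 < a)
    {δ : ℝ} (hδ : 0 < δ) {c : ℝ} {l : List (Set.Ioi (0 : ℝ) × ℝ)}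
    (hl : StepBounded ((1 - δ) / a) c l) (x : H) :
    ContinuousOn (fun t => stepFlow A B c l t x) (Set.Ici 0) := by
  induction l generalizing x with
  | nil =>
    exact ((hAB.isUnitaryGroupOf hΦ (abs_mul_lt_one ha hδ hl.1)).continuous x).continuousOn
  | cons p l ih =>
    obtain ⟨τ, d⟩ := p
    have hU := hAB.isUnitaryGroupOf hΦ (abs_mul_lt_one ha hδ hl.head)
    have h1 : ContinuousOn (fun t => stepFlow A B c ((τ, d) :: l) t x) (Set.Iic τ) := by
      refine (hU.continuous x).continuousOn.congr fun t ht => ?_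
      rw [stepFlow, if_pos (Set.mem_Iic.1 ht)]
    have h2 : ContinuousOn (fun t => stepFlow A B c ((τ, d) :: l) t x) (Set.Ici τ) := by
      have h3 := (ih hl.tail (unitaryGroup (A + (d : ℂ) • B) τ x)).comp
        (f := fun t : ℝ => t - τ) (s := Set.Ici (τ : ℝ)) (by fun_prop)
        (fun t ht => sub_nonneg.2 (Set.mem_Ici.1 ht))
      refine h3.congr fun t ht => ?_
      rw [hAB.stepFlow_cons_of_le hΦ ha hδ hl ht]
      rfl
    have h4 := h1.union_of_isClosed h2 isClosed_Iic isClosed_Ici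
    rw [Set.Iic_union_Ici] at h4
    exact h4.mono (Set.subset_univ _)

end KatoPair

/-! ### Right derivatives and `L¹` stability of step flows. -/

/-- The right-continuous version of `stepValue`. -/
def stepRight (c : ℝ) : List (Set.Ioi (0 : ℝ) × ℝ) → ℝ → ℝ
  | [], _ => c
  | (τ, d) :: l, t => if t < (τ : ℝ) then d else stepRight c l (t - τ)

theorem measurable_stepRight (c : ℝ) (l : List (Set.Ioi (0 : ℝ) × ℝ)) :
    Measurable (stepRight c l) := by
  induction l with
  | nil => exact measurable_const
  | cons p l ih =>
    exact Measurable.ite measurableSet_Iio measurable_const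
      (ih.comp (measurable_id.sub_const _))

theorem abs_stepRight_le {m c : ℝ} {l : List (Set.Ioi (0 : ℝ) × ℝ)} (hl : StepBounded m c l)
    (t : ℝ) : |stepRight c l t| ≤ m := by
  induction l generalizing t with
  | nil => exact hl.1
  | cons p l ih =>
    rw [stepRight]
    split_ifs
    · exact hl.head
    · exact ih hl.tail _

theorem exists_finite_stepRight_eq (c : ℝ) (l : List (Set.Ioi (0 : ℝ) × ℝ)) :
    ∃ F : Set ℝ, F.Finite ∧ ∀ t > 0, t ∉ F → stepRight c l t = stepValue c l t := by
  induction l with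
  | nil =>
    refine ⟨∅, Set.finite_empty, fun t ht _ => ?_⟩
    rw [stepRight, stepValue, if_neg (not_le.2 ht)]
  | cons p l ih =>
    obtain ⟨τ, d⟩ := p
    obtain ⟨F, hF, h⟩ := ih
    refine ⟨insert (τ : ℝ) ((fun s => s + (τ : ℝ)) '' F), (hF.image _).insert _,
      fun t ht htF => ?_⟩
    rw [Set.mem_insert_iff, not_or] at htF
    rw [stepRight, stepValue, if_neg (not_le.2 ht)]
    rcases lt_or_gt_of_ne htF.1 with hlt | hgt
    · rw [if_pos hlt, if_pos hlt.le]
    · rw [if_neg (not_lt.2 hgt.le), if_neg (not_le.2 hgt)]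
      refine h _ (sub_pos.2 hgt) fun hm => htF.2 ⟨_, hm, sub_add_cancel _ _⟩

namespace KatoPair

theorem hasDerivAt_unitaryGroup (hAB : KatoPair A B a b) (hΦ : IsDiagonalIn A Φ lam) {c : ℝ}
    (hc : |c| * a < 1) (x y : A.domain) (t : ℝ)
    (hy : (y : H) = unitaryGroup (A + (c : ℂ) • B) t x) :
    HasDerivAt (fun s => unitaryGroup (A + (c : ℂ) • B) s x) (A y + (c : ℂ) • hAB.pert y) t := by
  obtain ⟨z, hz, e⟩ := hAB.unitaryGroup_mem hΦ hc x t
  obtain rfl : y = z := Subtype.ext (hy.trans hz.symm)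
  rw [e]
  exact (hAB.isUnitaryGroupOf hΦ hc).hasDerivAt ⟨x, (hAB.mem_add_smul_domain c).2 x.2⟩ t

/-- The flow of a piecewise constant control solves the equation in the sense of right
derivatives. -/
theorem hasDerivWithinAt_stepFlow (hAB : KatoPair A B a b) (hΦ : IsDiagonalIn A Φ lam)
    (ha : 0 < a) {δ : ℝ} (hδ : 0 < δ) {c : ℝ} {l : List (Set.Ioi (0 : ℝ) × ℝ)}
    (hl : StepBounded ((1 - δ) / a) c l) {t : ℝ} (ht : 0 ≤ t) (x y : A.domain)
    (hy : (y : H) = stepFlow A B c l t x) :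
    HasDerivWithinAt (fun s => stepFlow A B c l s x)
      (A y + (stepRight c l t : ℂ) • hAB.pert y) (Set.Ici t) t := by
  induction l generalizing t x with
  | nil =>
    exact (hAB.hasDerivAt_unitaryGroup hΦ (abs_mul_lt_one ha hδ hl.1) x y t hy).hasDerivWithinAt
  | cons p l ih =>
    obtain ⟨τ, d⟩ := p
    have hd := abs_mul_lt_one ha hδ hl.head
    by_cases htτ : t < τ
    · rw [stepFlow, if_pos htτ.le] at hy
      rw [stepRight, if_pos htτ]
      refine ((hAB.hasDerivAt_unitaryGroup hΦ hd x y t hy).congr_of_eventuallyEq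
        ?_).hasDerivWithinAt
      filter_upwards [eventually_le_nhds htτ] with s hs
      rw [stepFlow, if_pos hs]
    · have htτ' : (τ : ℝ) ≤ t := not_lt.1 htτ
      obtain ⟨z, hz, -⟩ := hAB.unitaryGroup_mem hΦ hd x τ
      rw [hAB.stepFlow_cons_of_le hΦ ha hδ hl htτ', mul_apply_eq_comp, ← hz] at hy
      rw [stepRight, if_neg htτ]
      have h1 := ih hl.tail (sub_nonneg.2 htτ') z hy
      have h2 : HasDerivWithinAt (fun s : ℝ => s - τ) 1 (Set.Ici t) t :=
        ((hasDerivAt_id t).sub_const _).hasDerivWithinAt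
      have h3 := h1.scomp t h2 (fun s hs => sub_le_sub_right (Set.mem_Ici.1 hs) _)
      rw [one_smul] at h3
      refine h3.congr (fun s hs => ?_) ?_
      · rw [hAB.stepFlow_cons_of_le hΦ ha hδ hl (htτ'.trans hs), mul_apply_eq_comp, ← hz]
        rfl
      · rw [hAB.stepFlow_cons_of_le hΦ ha hδ hl htτ', mul_apply_eq_comp, ← hz]
        rfl

/-- Two flows of piecewise constant controls are close if the controls are close in `L¹`. -/
theorem norm_stepFlow_sub_sq_le (hAB : KatoPair A B a b) (hΦ : IsDiagonalIn A Φ lam)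
    (ha : 0 < a) {δ : ℝ} (hδ : 0 < δ) {c c' : ℝ} {l l' : List (Set.Ioi (0 : ℝ) × ℝ)}
    (hl : StepBounded ((1 - δ) / a) c l) (hl' : StepBounded ((1 - δ) / a) c' l') {C : ℝ}
    (x : A.domain)
    (hC : ∀ t, ∀ y : A.domain, (y : H) = stepFlow A B c' l' t x → ‖hAB.pert y‖ ≤ C)
    {t : ℝ} (ht : 0 ≤ t) :
    ‖stepFlow A B c l t x - stepFlow A B c' l' t x‖ ^ 2
      ≤ ∫ s in (0 : ℝ)..t, 4 * ‖(x : H)‖ * C * |stepRight c l s - stepRight c' l' s| := by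
  have hm : 0 ≤ (1 - δ) / a := (abs_nonneg _).trans hl.1
  have h00 : |(0 : ℝ)| ≤ (1 - δ) / a := by rwa [abs_zero]
  choose y hy using fun s => (hAB.stepFlow_energy hΦ ha hδ h00 hl s x)
  choose y' hy' using fun s => (hAB.stepFlow_energy hΦ ha hδ h00 hl' s x)
  set z : ℝ → H := fun s => stepFlow A B c l s x - stepFlow A B c' l' s x with hz
  set z' : ℝ → H := fun s => (A (y s) + (stepRight c l s : ℂ) • hAB.pert (y s))
    - (A (y' s) + (stepRight c' l' s : ℂ) • hAB.pert (y' s)) with hz'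
  have hzy : ∀ s, z s = ((y s - y' s : A.domain) : H) := fun s => by
    rw [Submodule.coe_sub, (hy s).1, (hy' s).1]
  have hcont : ContinuousOn (fun s => (⟪z s, z s⟫_ℂ).re) (Set.Icc 0 t) := by
    have h1 : ContinuousOn z (Set.Icc 0 t) :=
      ((hAB.continuousOn_stepFlow hΦ ha hδ hl x).sub
        (hAB.continuousOn_stepFlow hΦ ha hδ hl' x)).mono Set.Icc_subset_Ici_self
    exact Complex.continuous_re.comp_continuousOn (h1.inner h1)
  have hderiv : ∀ s ∈ Set.Ioo 0 t, HasDerivWithinAt (fun s => (⟪z s, z s⟫_ℂ).re)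
      (2 * (⟪z s, z' s⟫_ℂ).re) (Set.Ioi s) s := by
    intro s hs
    have h1 : HasDerivWithinAt z (z' s) (Set.Ici s) s :=
      (hAB.hasDerivWithinAt_stepFlow hΦ ha hδ hl hs.1.le x (y s) (hy s).1).fun_sub
        (hAB.hasDerivWithinAt_stepFlow hΦ ha hδ hl' hs.1.le x (y' s) (hy' s).1)
    have h2 := (Complex.reCLM.hasFDerivAt.comp_hasDerivWithinAt s (h1.inner ℂ h1)).mono
      (Set.Ioi_subset_Ici_self)
    have e : Complex.reCLM (⟪z s, z' s⟫_ℂ + ⟪z' s, z s⟫_ℂ) = 2 * (⟪z s, z' s⟫_ℂ).re := by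
      rw [Complex.reCLM_apply, Complex.add_re, ← inner_conj_symm (z' s), Complex.conj_re, two_mul]
    rw [e] at h2
    exact h2
  have hbound : ∀ s ∈ Set.Ioo 0 t, 2 * (⟪z s, z' s⟫_ℂ).re
      ≤ 4 * ‖(x : H)‖ * C * |stepRight c l s - stepRight c' l' s| := by
    intro s _
    set v := stepRight c l s
    set w := stepRight c' l' s
    -- The first two terms form a skew operator applied to `z s` and drop out of `Re ⟨z, z'⟩`; only
    -- `(v - w) B y'` remains, so `B` need be bounded along one flow only.
    have e : z' s = A (y s - y' s) + (v : ℂ) • hAB.pert (y s - y' s)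
        + ((v - w : ℝ) : ℂ) • hAB.pert (y' s) := by
      rw [hz', A.map_sub, map_sub]
      push_cast
      module
    have h1 := inner_eq_re_zero_of_skew hAB.skew (y s - y' s)
    have h2 : (⟪z s, (v : ℂ) • hAB.pert (y s - y' s)⟫_ℂ).re = 0 := by
      have h := congrArg Complex.re (hAB.pert_skew (y s - y' s) (y s - y' s))
      rw [← inner_conj_symm, Complex.conj_re, Complex.neg_re] at h
      rw [hzy, inner_smul_right, Complex.re_ofReal_mul]
      have h' : (⟪((y s - y' s : A.domain) : H), hAB.pert (y s - y' s)⟫_ℂ).re = 0 := by linarith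
      rw [h', mul_zero]
    have h3 : (⟪z s, z' s⟫_ℂ).re = (v - w) * (⟪z s, hAB.pert (y' s)⟫_ℂ).re := by
      rw [e, inner_add_right, inner_add_right, Complex.add_re, Complex.add_re, h2,
        inner_smul_right (z s) _ ((v - w : ℝ) : ℂ), Complex.re_ofReal_mul]
      rw [hzy, h1]
      ring
    -- This 2, with the 2 from differentiating the square, gives the constant 4.
    have h4 : ‖z s‖ ≤ 2 * ‖(x : H)‖ := by
      refine (norm_sub_le _ _).trans ?_
      rw [hAB.norm_stepFlow hΦ ha hδ hl, hAB.norm_stepFlow hΦ ha hδ hl', two_mul]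
    have h5 : |(⟪z s, hAB.pert (y' s)⟫_ℂ).re| ≤ 2 * ‖(x : H)‖ * C :=
      ((Complex.abs_re_le_norm _).trans (norm_inner_le_norm _ _)).trans
        (mul_le_mul h4 (hC s _ (hy' s).1) (norm_nonneg _) (by positivity))
    have h6 := mul_le_mul_of_nonneg_left h5 (abs_nonneg (v - w))
    rw [← abs_mul, ← h3] at h6
    have h7 := le_abs_self (⟪z s, z' s⟫_ℂ).re
    linarith
  have hint : IntegrableOn (fun s => 4 * ‖(x : H)‖ * C * |stepRight c l s - stepRight c' l' s|)
      (Set.Icc 0 t) := by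
    refine Integrable.const_mul ?_ _
    have hmeas : Measurable fun s => |stepRight c l s - stepRight c' l' s| :=
      ((measurable_stepRight c l).sub (measurable_stepRight c' l')).abs
    refine Measure.integrableOn_of_bounded (M := (1 - δ) / a + (1 - δ) / a)
      measure_Icc_lt_top.ne hmeas.aestronglyMeasurable (Eventually.of_forall fun s => ?_)
    rw [Real.norm_eq_abs, abs_abs]
    exact (abs_sub _ _).trans (add_le_add (abs_stepRight_le hl s) (abs_stepRight_le hl' s))
  have h := intervalIntegral.sub_le_integral_of_hasDeriv_right_of_le ht hcont hderiv hint hbound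
  have hnorm : ∀ s, (⟪z s, z s⟫_ℂ).re = ‖z s‖ ^ 2 := fun s => by
    rw [inner_self_eq_norm_sq_to_K]
    simp [← Complex.ofReal_pow]
  have hz0 : z 0 = 0 := by
    rw [hz]
    simp only [hAB.stepFlow_zero hΦ ha hδ hl, hAB.stepFlow_zero hΦ ha hδ hl', sub_self]
  rw [hnorm, hnorm, hz0, norm_zero] at h
  simpa using h

end KatoPair

/-! ### Approximation of controls by sampling, and `L¹` convergence. -/

/-- The pieces of length `τ` with values `f 0, …, f (k - 1)`. -/
def samplePieces (τ : Set.Ioi (0 : ℝ)) : (ℕ → ℝ) → ℕ → List (Set.Ioi (0 : ℝ) × ℝ)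
  | _, 0 => []
  | f, k + 1 => (τ, f 0) :: samplePieces τ (fun i => f (i + 1)) k

/-- Piece `i` occupies `(iτ, (i+1)τ]`, hence the ceiling minus one; the minimum accounts for the
last value. -/
theorem stepValue_samplePieces (τ : Set.Ioi (0 : ℝ)) (f : ℕ → ℝ) (k : ℕ) {t : ℝ} (ht : 0 < t) :
    stepValue (f k) (samplePieces τ f k) t = f (min (⌈t / (τ : ℝ)⌉₊ - 1) k) := by
  have hτ : (0 : ℝ) < τ := τ.2
  induction k generalizing f t with
  | zero => rw [samplePieces, stepValue, if_neg (not_le.2 ht), Nat.min_zero]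
  | succ k ih =>
    rw [samplePieces, stepValue, if_neg (not_le.2 ht)]
    split_ifs with h
    · have h1 : ⌈t / (τ : ℝ)⌉₊ ≤ 1 := by
        rw [Nat.ceil_le, Nat.cast_one, div_le_one hτ]
        exact h
      rw [Nat.sub_eq_zero_of_le h1, Nat.zero_min]
    · have h1 : 1 < ⌈t / (τ : ℝ)⌉₊ := by
        rw [Nat.lt_ceil, Nat.cast_one, one_lt_div hτ]
        exact not_le.1 h
      rw [ih (fun i => f (i + 1)) (sub_pos.2 (not_le.1 h)), sub_div, div_self hτ.ne',
        Nat.ceil_sub_one]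
      congr 1
      omega

/-- The control that samples `u` at the points `τ, 2τ, …, (k + 1) τ`. -/
def sampleControl (u : ℝ → ℝ) (τ : Set.Ioi (0 : ℝ)) (k : ℕ) : StepControl where
  pieces := samplePieces τ (fun i => u ((i + 1 : ℕ) * τ)) k
  last := u ((k + 1 : ℕ) * τ)

/-- The sample is `u` composed with a monotone map, so its variation cannot exceed that of `u`.
Times `t ≤ 0` go to 0 because the natural ceiling vanishes there. -/
theorem sampleControl_toFun {u : ℝ → ℝ} (hu : ∀ t ≤ 0, u t = 0) (τ : Set.Ioi (0 : ℝ)) (k : ℕ) :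
    (sampleControl u τ k).toFun = u ∘ fun t : ℝ => (min ⌈t / (τ : ℝ)⌉₊ (k + 1) : ℕ) * (τ : ℝ) := by
  have hτ : (0 : ℝ) < τ := τ.2
  funext t
  rw [StepControl.toFun, Function.comp]
  rcases le_or_gt t 0 with ht | ht
  · rw [stepValue_of_nonpos _ _ ht, Nat.ceil_eq_zero.2 (div_nonpos_of_nonpos_of_nonneg ht hτ.le),
      Nat.zero_min, Nat.cast_zero, zero_mul, hu 0 le_rfl]
  · have h1 : 0 < ⌈t / (τ : ℝ)⌉₊ := Nat.ceil_pos.2 (div_pos ht hτ)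
    have h2 := stepValue_samplePieces τ (fun i => u ((i + 1 : ℕ) * τ)) k ht
    refine h2.trans ?_
    have e : min (⌈t / (τ : ℝ)⌉₊ - 1) k + 1 = min ⌈t / (τ : ℝ)⌉₊ (k + 1) := by omega
    simp only [e]

theorem monotone_sample (τ : Set.Ioi (0 : ℝ)) (k : ℕ) :
    Monotone fun t : ℝ => (min ⌈t / (τ : ℝ)⌉₊ (k + 1) : ℕ) * (τ : ℝ) := by
  have hτ : (0 : ℝ) < τ := τ.2
  intro s t hst
  refine mul_le_mul_of_nonneg_right (Nat.cast_le.2 (min_le_min_right _ (Nat.ceil_mono ?_))) hτ.le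
  exact div_le_div_of_nonneg_right hst hτ.le

/-- Every control of bounded variation has piecewise constant approximations. -/
theorem exists_approximates {δ : ℝ} {u : ℝ → ℝ} (hu : u ∈ admissible δ a) :
    ∃ v, Approximates δ a u v := by
  let τ : ℕ → Set.Ioi (0 : ℝ) := fun n => ⟨((n : ℝ) + 1)⁻¹, Set.mem_Ioi.2 (by positivity)⟩
  -- About `(n+1)²` pieces of length `1/(n+1)`: the mesh shrinks while the sampled window grows past
  -- every `t`.
  let v : ℕ → StepControl := fun n => sampleControl u (τ n) ((n + 1) * (n + 1))
  have hv : ∀ n, (v n).toFun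
      = u ∘ fun t : ℝ => (min ⌈t / (τ n : ℝ)⌉₊ ((n + 1) * (n + 1) + 1) : ℕ) * (τ n : ℝ) :=
    fun n => sampleControl_toFun hu.2.1 _ _
  have hvar : ∀ n, eVariationOn (v n).toFun Set.univ ≤ eVariationOn u Set.univ := fun n => by
    rw [hv]
    exact eVariationOn.comp_le_of_monotoneOn u _ ((monotone_sample _ _).monotoneOn _)
      (Set.mapsTo_univ _ _)
  refine ⟨v, fun n => ⟨((hvar n).trans_lt hu.1.lt_top).ne, fun t ht => stepValue_of_nonpos _ _ ht,
    fun t => ?_⟩, fun n => ENNReal.toReal_mono hu.1 (hvar n), ?_⟩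
  · rw [hv]
    exact hu.2.2 _
  -- A function of bounded variation is differentiable, hence continuous, almost everywhere; there
  -- the values at the sampling points converge.
  · filter_upwards [hu.1.locallyBoundedVariationOn.ae_differentiableAt] with t ht
    rcases le_or_gt t 0 with h0 | h0
    · have e : ∀ n, (v n).toFun t = u t := fun n => by
        rw [hu.2.1 t h0]
        exact stepValue_of_nonpos _ _ h0
      simp only [e, tendsto_const_nhds]
    · simp only [hv]
      refine ht.continuousAt.tendsto.comp ?_
      have hτ0 : Tendsto (fun n => t + (τ n : ℝ)) atTop (𝓝 t) := by
        have h := (tendsto_one_div_add_atTop_nhds_zero_nat (𝕜 := ℝ)).const_add t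
        simpa [τ] using h
      have hlarge : ∀ᶠ n : ℕ in atTop, ⌈t / (τ n : ℝ)⌉₊ ≤ (n + 1) * (n + 1) + 1 := by
        filter_upwards [eventually_ge_atTop ⌈t⌉₊] with n hn
        have h1 : t ≤ n := Nat.ceil_le.1 hn
        rw [Nat.ceil_le]
        have e : t / (τ n : ℝ) = t * (n + 1) := by simp [τ]
        rw [e]
        push_cast
        nlinarith
      refine tendsto_of_tendsto_of_tendsto_of_le_of_le' tendsto_const_nhds hτ0 ?_ ?_
      · filter_upwards [hlarge] with n hn
        rw [min_eq_left hn, ← div_le_iff₀ (τ n).2]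
        exact Nat.le_ceil _
      · filter_upwards [hlarge] with n hn
        have hτn : (0 : ℝ) < τ n := (τ n).2
        have h1 := Nat.ceil_lt_add_one (div_pos h0 hτn).le
        have h2 := mul_le_mul_of_nonneg_right h1.le hτn.le
        rw [add_mul, one_mul, div_mul_cancel₀ _ hτn.ne'] at h2
        rw [min_eq_left hn]
        exact h2

theorem Approximates.ae_tendsto_stepRight {δ : ℝ} {u : ℝ → ℝ} {v : ℕ → StepControl}
    (hv : Approximates δ a u v) :
    ∀ᵐ t : ℝ, 0 < t →
      Tendsto (fun n => stepRight (v n).last (v n).pieces t) atTop (𝓝 (u t)) := by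
  choose F hF hFeq using fun n => exists_finite_stepRight_eq (v n).last (v n).pieces
  have h : ∀ᵐ t : ℝ, ∀ n, t ∉ F n :=
    ae_all_iff.2 fun n => (hF n).countable.ae_notMem volume
  filter_upwards [h, hv.tendsto] with t h1 h2 ht
  exact h2.congr fun n => (hFeq n t ht (h1 n)).symm

/-- Dominated convergence, with the uniform bound on admissible values. The product filter serves
both the Cauchy property and the comparison of two sequences. -/
theorem Approximates.tendsto_integral {δ : ℝ} {u : ℝ → ℝ} {v w : ℕ → StepControl}
    (hv : Approximates δ a u v) (hw : Approximates δ a u w) (K : ℝ) {t : ℝ} (ht : 0 ≤ t) :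
    Tendsto (fun p : ℕ × ℕ => ∫ s in (0 : ℝ)..t, K *
      |stepRight (v p.1).last (v p.1).pieces s - stepRight (w p.2).last (w p.2).pieces s|)
      (atTop ×ˢ atTop) (𝓝 0) := by
  have e : 𝓝 (0 : ℝ) = 𝓝 (∫ s in (0 : ℝ)..t, (0 : ℝ)) := by simp
  rw [e]
  refine intervalIntegral.tendsto_integral_filter_of_dominated_convergence
    (fun _ => |K| * ((1 - δ) / a + (1 - δ) / a)) (Eventually.of_forall fun p => ?_)
    (Eventually.of_forall fun p => Eventually.of_forall fun s _ => ?_)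
    ?_ ?_
  · exact (((measurable_stepRight _ _).sub (measurable_stepRight _ _)).abs.const_mul
      K).aestronglyMeasurable
  · rw [norm_mul, Real.norm_eq_abs, Real.norm_eq_abs, abs_abs]
    refine mul_le_mul_of_nonneg_left ((abs_sub _ _).trans (add_le_add ?_ ?_)) (abs_nonneg K)
    · exact abs_stepRight_le (stepBounded_of_admissible (hv.mem _)) s
    · exact abs_stepRight_le (stepBounded_of_admissible (hw.mem _)) s
  · exact intervalIntegrable_const
  · filter_upwards [hv.ae_tendsto_stepRight, hw.ae_tendsto_stepRight] with s h1 h2 hs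
    rw [Set.uIoc_of_le ht] at hs
    have h3 := (((h1 hs.1).comp (tendsto_fst (g := atTop (α := ℕ)))).sub
      ((h2 hs.1).comp (tendsto_snd (f := atTop (α := ℕ))))).abs.const_mul K
    rw [sub_self, abs_zero, mul_zero] at h3
    exact h3

/-! ### The propagator as a limit. -/

namespace KatoPair

theorem flow_energy (hAB : KatoPair A B a b) (hΦ : IsDiagonalIn A Φ lam) (ha : 0 < a) {δ : ℝ}
    (hδ : 0 < δ) {V : ℝ} {v : StepControl} (hv : v.toFun ∈ admissible δ a)
    (hV : totalVariation v.toFun ≤ V) (t : ℝ) (x : A.domain) :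
    ∃ y : A.domain, (y : H) = v.flow A B t x ∧
      hAB.energy 0 y ≤ Real.exp (2 * (a / δ) * V) * hAB.energy 0 x ∧
      hAB.shiftedEnergy 0 y
        ≤ hAB.shiftedEnergy 0 x + (Real.exp (2 * (a / δ) * V) - 1) * hAB.energy 0 x := by
  have hl := stepBounded_of_admissible hv
  have h00 : |(0 : ℝ)| ≤ (1 - δ) / a := by
    rw [abs_zero]; exact (abs_nonneg _).trans hl.1
  obtain ⟨y, hy, h1, h2⟩ := hAB.stepFlow_energy hΦ ha hδ h00 hl t x
  have hJ := (jumpSum_le_totalVariation hv).trans hV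
  have hE : Real.exp (2 * (a / δ) * jumpSum v.last 0 v.pieces)
      ≤ Real.exp (2 * (a / δ) * V) :=
    Real.exp_le_exp.2 (mul_le_mul_of_nonneg_left hJ (by positivity))
  have hM := mul_le_mul_of_nonneg_right hE (hAB.energy_nonneg 0 x)
  exact ⟨y, hy, h1.trans hM, by linarith⟩

/-- The energy bound in terms of `totalVariation u` bounds `B` uniformly along all approximating
flows, so `L¹` stability applies. Taking `v = w` yields convergence; two sequences yield
independence of the choice. -/
theorem tendsto_flow_sub (hAB : KatoPair A B a b) (hΦ : IsDiagonalIn A Φ lam) (ha : 0 < a) {δ : ℝ}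
    (hδ : 0 < δ) {u : ℝ → ℝ} {v w : ℕ → StepControl} (hv : Approximates δ a u v)
    (hw : Approximates δ a u w) {t : ℝ} (ht : 0 ≤ t) (x : A.domain) :
    Tendsto (fun p : ℕ × ℕ => dist ((v p.1).flow A B t x) ((w p.2).flow A B t x))
      (atTop ×ˢ atTop) (𝓝 0) := by
  set C : ℝ := a / δ * (Real.exp (2 * (a / δ) * totalVariation u) * hAB.energy 0 x) with hC
  have hbound : ∀ p : ℕ × ℕ, dist ((v p.1).flow A B t x) ((w p.2).flow A B t x) ^ 2
      ≤ ∫ s in (0 : ℝ)..t, 4 * ‖(x : H)‖ * C *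
        |stepRight (v p.1).last (v p.1).pieces s - stepRight (w p.2).last (w p.2).pieces s| := by
    intro p
    rw [dist_eq_norm]
    have hl := stepBounded_of_admissible (hv.mem p.1)
    refine hAB.norm_stepFlow_sub_sq_le hΦ ha hδ hl (stepBounded_of_admissible (hw.mem p.2)) x
      (fun s y hy => ?_) ht
    obtain ⟨z, hz, h1, -⟩ := hAB.flow_energy hΦ ha hδ (hw.mem p.2) (hw.variation_le p.2) s x
    obtain rfl : y = z := Subtype.ext (hy.trans hz.symm)
    refine (hAB.norm_pert_le_energy ha hδ ?_ y).trans
      (mul_le_mul_of_nonneg_left h1 (by positivity))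
    rw [abs_zero]
    exact (abs_nonneg _).trans hl.1
  have h := squeeze_zero (fun _ => sq_nonneg _) hbound (hv.tendsto_integral hw _ ht)
  have h' := h.sqrt
  rw [Real.sqrt_zero] at h'
  exact h'.congr fun p => Real.sqrt_sq dist_nonneg

/-- The propagator exists on the domain of `A`. -/
theorem exists_isPropagatorValue (hAB : KatoPair A B a b) (hΦ : IsDiagonalIn A Φ lam) (ha : 0 < a)
    {δ : ℝ} (hδ : 0 < δ) {u : ℝ → ℝ} (hu : u ∈ admissible δ a) {t : ℝ} (ht : 0 ≤ t)
    (x : A.domain) : ∃ y, IsPropagatorValue δ a A B u t x y := by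
  obtain ⟨v, hv⟩ := exists_approximates hu
  have hcauchy : CauchySeq fun n => (v n).flow A B t x := by
    rw [cauchySeq_iff_tendsto_dist_atTop_0, ← prod_atTop_atTop_eq]
    exact hAB.tendsto_flow_sub hΦ ha hδ hv hv ht x
  obtain ⟨y, hy⟩ := cauchySeq_tendsto_of_complete hcauchy
  refine ⟨y, ⟨v, hv⟩, fun w hw => ?_⟩
  have h := (hAB.tendsto_flow_sub hΦ ha hδ hw hv ht x).comp
    (tendsto_id.prodMk (tendsto_id (α := ℕ)))
  exact (tendsto_iff_of_dist h).2 hy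

theorem isPropagatorValue_propagator (hAB : KatoPair A B a b) (hΦ : IsDiagonalIn A Φ lam)
    (ha : 0 < a) {δ : ℝ} (hδ : 0 < δ) {u : ℝ → ℝ} (hu : u ∈ admissible δ a) {t : ℝ} (ht : 0 ≤ t)
    (x : A.domain) : IsPropagatorValue δ a A B u t x (propagator δ a A B u t x) := by
  have h := hAB.exists_isPropagatorValue hΦ ha hδ hu ht x
  rw [propagator, dif_pos h]
  exact h.choose_spec

end KatoPair

/-! ### Coefficient estimates and passage to the limit. -/

theorem hasSum_norm_coeff_sq (Φ : HilbertBasis ℕ ℂ H) (x : H) :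
    HasSum (fun k => ‖⟪Φ k, x⟫_ℂ‖ ^ 2) (‖x‖ ^ 2) := by
  have h := Complex.hasSum_re (Φ.hasSum_inner_mul_inner x x)
  have e : (⟪x, x⟫_ℂ).re = ‖x‖ ^ 2 := by
    rw [inner_self_eq_norm_sq_to_K]
    simp [← Complex.ofReal_pow]
  rw [e] at h
  refine h.congr_fun fun k => ?_
  rw [← inner_conj_symm x, mul_comm, Complex.mul_conj, Complex.ofReal_re, Complex.normSq_eq_norm_sq]

theorem norm_le_of_coeff_le (Φ : HilbertBasis ℕ ℂ H) {x y : H}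
    (h : ∀ k, ‖⟪Φ k, x⟫_ℂ‖ ≤ ‖⟪Φ k, y⟫_ℂ‖) : ‖x‖ ≤ ‖y‖ :=
  le_of_sq_le_sq (hasSum_le (fun k => pow_le_pow_left₀ (norm_nonneg _) (h k) 2)
    (hasSum_norm_coeff_sq Φ x) (hasSum_norm_coeff_sq Φ y)) (norm_nonneg _)

theorem inner_basis_diagOp (Φ : HilbertBasis ℕ ℂ H) (c : ℕ → ℝ) (x : (diagOp Φ c).domain) (k : ℕ) :
    ⟪Φ k, diagOp Φ c x⟫_ℂ = c k * ⟪Φ k, (x : H)⟫_ℂ := by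
  rw [← Φ.repr_apply_apply]
  change Φ.repr (Φ.repr.symm ⟨fun j => (c j : ℂ) * ⟪Φ j, (x : H)⟫_ℂ, x.2⟩) k = _
  rw [LinearIsometryEquiv.apply_symm_apply]

/-- Uniform bounds on finite partial sums give membership and norm bound together, so nothing need
be known beforehand about the domain. -/
theorem exists_mem_diagOp_domain (Φ : HilbertBasis ℕ ℂ H) {c : ℕ → ℝ} {x : H} {R : ℝ} (hR : 0 ≤ R)
    (h : ∀ s : Finset ℕ, ∑ k ∈ s, ‖(c k : ℂ) * ⟪Φ k, x⟫_ℂ‖ ^ 2 ≤ R ^ 2) :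
    ∃ hx : x ∈ (diagOp Φ c).domain, ‖diagOp Φ c ⟨x, hx⟩‖ ≤ R := by
  have hx : Memℓp (fun k => (c k : ℂ) * ⟪Φ k, x⟫_ℂ) 2 :=
    memℓp_gen' (C := R ^ 2) fun s => by simpa using h s
  refine ⟨hx, le_of_sq_le_sq ?_ hR⟩
  refine hasSum_le_of_sum_le (hasSum_norm_coeff_sq Φ _) fun s => ?_
  simp only [inner_basis_diagOp]
  exact h s

theorem inner_basis_basisProj (Φ : HilbertBasis ℕ ℂ H) (N : ℕ) (x : H) (k : ℕ) :
    ⟪Φ k, x - basisProj Φ N x⟫_ℂ = if k ≤ N then 0 else ⟪Φ k, x⟫_ℂ := by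
  rw [inner_sub_right, basisProj, inner_sum]
  simp only [inner_smul_right, orthonormal_iff_ite.1 Φ.orthonormal, mul_ite, mul_one, mul_zero,
    Finset.sum_ite_eq, Finset.mem_range, Nat.lt_succ_iff]
  split_ifs <;> simp

namespace KatoPair

/-- Both `|λ_k|` and `|1 + λ_k|` are at most `1 + |λ_k|`. -/
theorem mem_domain_of_onePlusAbs (hAB : KatoPair A B a b) (hΦ : IsDiagonalIn A Φ lam)
    (x : (onePlusAbsPow Φ lam 1).domain) :
    ∃ h : (x : H) ∈ A.domain, ‖A ⟨x, h⟩‖ ≤ ‖onePlusAbsPow Φ lam 1 x‖ ∧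
      ‖A ⟨x, h⟩ - Complex.I • (x : H)‖ ≤ ‖onePlusAbsPow Φ lam 1 x‖ := by
  have hw : ∀ k, ‖⟪Φ k, onePlusAbsPow Φ lam 1 x⟫_ℂ‖ = (1 + |lam k|) * ‖⟪Φ k, (x : H)⟫_ℂ‖ :=
    fun k => by
      have h : ⟪Φ k, onePlusAbsPow Φ lam 1 x⟫_ℂ = _ :=
        inner_basis_diagOp Φ (fun j => (1 + |lam j|) ^ (1 : ℝ)) x k
      have h0 : 0 ≤ 1 + |lam k| := by positivity
      rw [h, norm_mul, Real.rpow_one, Complex.norm_real, Real.norm_of_nonneg h0]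
  obtain ⟨z, hz⟩ := exists_coeff_eq Φ (f := fun k => -Complex.I * lam k * ⟪Φ k, (x : H)⟫_ℂ)
    (memℓp_two_of_norm_le (C := 1) (memℓp_two_coeff Φ (onePlusAbsPow Φ lam 1 x)) fun k => by
      rw [hw, one_mul, norm_mul]
      refine mul_le_mul_of_nonneg_right ?_ (norm_nonneg _)
      simp)
  obtain ⟨h, rfl⟩ := hAB.mem_domain_of_coeff hΦ hz
  refine ⟨h, norm_le_of_coeff_le Φ fun k => ?_, norm_le_of_coeff_le Φ fun k => ?_⟩
  · rw [hw, hz, norm_mul]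
    refine mul_le_mul_of_nonneg_right ?_ (norm_nonneg _)
    simp
  · rw [hw, inner_sub_right, inner_smul_right, hz, ← sub_mul, norm_mul]
    refine mul_le_mul_of_nonneg_right ?_ (norm_nonneg _)
    have e : -Complex.I * lam k - Complex.I = -Complex.I * ((1 + lam k : ℝ) : ℂ) := by
      push_cast; ring
    rw [e, norm_mul, norm_neg, Complex.norm_I, one_mul, Complex.norm_real, Real.norm_eq_abs]
    exact (abs_add_le _ _).trans (by rw [abs_one])

theorem norm_inner_basis_shifted (hAB : KatoPair A B a b) (hΦ : IsDiagonalIn A Φ lam)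
    (x : A.domain) (k : ℕ) :
    ‖⟪Φ k, A x - Complex.I • (x : H)⟫_ℂ‖ = |1 + lam k| * ‖⟪Φ k, (x : H)⟫_ℂ‖ := by
  rw [inner_sub_right, inner_smul_right, hAB.inner_basis hΦ]
  have e : -Complex.I * lam k * ⟪Φ k, (x : H)⟫_ℂ - Complex.I * ⟪Φ k, (x : H)⟫_ℂ
      = -Complex.I * ((1 + lam k : ℝ) : ℂ) * ⟪Φ k, (x : H)⟫_ℂ := by
    push_cast; ring
  rw [e, norm_mul, norm_mul, norm_neg, Complex.norm_I, one_mul, Complex.norm_real,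
    Real.norm_eq_abs]

/-- The weighted sums of the coefficients of the propagated vector are controlled by the energies
of the initial vector. -/
theorem sum_coeff_propagator_le (hAB : KatoPair A B a b) (hΦ : IsDiagonalIn A Φ lam) (ha : 0 < a)
    {δ : ℝ} (hδ : 0 < δ) {u : ℝ → ℝ} (hu : u ∈ admissible δ a) {t : ℝ} (ht : 0 ≤ t)
    (x : A.domain) (s : Finset ℕ) :
    ∑ k ∈ s, (|1 + lam k| * ‖⟪Φ k, propagator δ a A B u t x⟫_ℂ‖) ^ 2
      ≤ (hAB.shiftedEnergy 0 x
        + (Real.exp (2 * (a / δ) * totalVariation u) - 1) * hAB.energy 0 x) ^ 2 := by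
  obtain ⟨⟨v, hv⟩, hlim⟩ := hAB.isPropagatorValue_propagator hΦ ha hδ hu ht x
  have hlim' := hlim v hv
  have h1 : Tendsto (fun n => ∑ k ∈ s, (|1 + lam k| * ‖⟪Φ k, (v n).flow A B t x⟫_ℂ‖) ^ 2) atTop
      (𝓝 (∑ k ∈ s, (|1 + lam k| * ‖⟪Φ k, propagator δ a A B u t x⟫_ℂ‖) ^ 2)) :=
    -- Only finitely many coefficients are involved, so convergence in `H` suffices.
    tendsto_finsetSum _ fun k _ => ((tendsto_const_nhds.inner hlim').norm.const_mul _).pow 2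
  refine le_of_tendsto' h1 fun n => ?_
  obtain ⟨y, hy, -, h2⟩ := hAB.flow_energy hΦ ha hδ (hv.mem n) (hv.variation_le n) t x
  rw [← hy]
  refine le_trans ?_ (pow_le_pow_left₀ (norm_nonneg _) h2 2)
  have e : hAB.shiftedEnergy 0 y = ‖A y - Complex.I • (y : H)‖ := by simp [shiftedEnergy]
  change _ ≤ hAB.shiftedEnergy 0 y ^ 2
  rw [e]
  simp only [← hAB.norm_inner_basis_shifted hΦ y]
  exact sum_le_hasSum s (fun k _ => sq_nonneg _) (hasSum_norm_coeff_sq Φ _)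

end KatoPair

/-- Since `λ_k^p → ∞`, the infimum is attained, hence positive. -/
theorem iInf_rpow_pos {N : ℕ} (hN : ∀ j, N < j → 0 < lam j) (hlam : Tendsto lam atTop atTop)
    {p : ℝ} (hp : 0 < p) :
    0 < ⨅ k : Set.Ioi N, lam k ^ p ∧ ∀ k, N < k → ⨅ k : Set.Ioi N, lam k ^ p ≤ lam k ^ p := by
  have hpos : ∀ k : Set.Ioi N, 0 < lam k ^ p := fun k => Real.rpow_pos_of_pos (hN k k.2) p
  have h1 : Tendsto (fun k : Set.Ioi N => lam k ^ p) cofinite atTop := by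
    have h2 := (tendsto_rpow_atTop hp).comp hlam
    rw [← Nat.cofinite_eq_atTop] at h2
    exact h2.comp Subtype.val_injective.tendsto_cofinite
  have : Nonempty (Set.Ioi N) := ⟨⟨N + 1, Nat.lt_succ_self N⟩⟩
  obtain ⟨k₀, hk₀⟩ := h1.exists_forall_le
  refine ⟨(hpos k₀).trans_le (le_ciInf hk₀), fun k hk => ?_⟩
  exact ciInf_le ⟨0, by rintro _ ⟨k, rfl⟩; exact (hpos k).le⟩ (⟨k, hk⟩ : Set.Ioi N)

/-- `I ≤ l^(1-r) ≤ (1 + l)^(1-r)`; the weight `1 + l` on the right is the one supplied by the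
shifted energy. -/
theorem one_add_rpow_le {l r I : ℝ} (hl : 0 < l) (hr : r < 1) (hI : 0 < I)
    (hIl : I ≤ l ^ (1 - r)) : (1 + l) ^ r ≤ (1 + l) / I := by
  have h1 : 0 < 1 + l := by linarith
  rw [le_div_iff₀ hI]
  calc (1 + l) ^ r * I ≤ (1 + l) ^ r * (1 + l) ^ (1 - r) := by
        refine mul_le_mul_of_nonneg_left (hIl.trans ?_) (Real.rpow_nonneg h1.le _)
        exact Real.rpow_le_rpow hl.le (by linarith) (by linarith)
    _ = 1 + l := by rw [← Real.rpow_add h1, add_sub_cancel, Real.rpow_one]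

end BilinearSchrodinger

end
theorem mainTheorem4 {H : Type*} [NormedAddCommGroup H] [InnerProductSpace ℂ H]
    [CompleteSpace H] (A B : H →ₗ.[ℂ] H) (a b : ℝ) (hAB : KatoPair A B a b) (ha : 0 < a)
    (Φ : HilbertBasis ℕ ℂ H) (lam : ℕ → ℝ) (hΦ : IsDiagonalIn A Φ lam)
    (δ : ℝ) (hδ : δ ∈ Set.Ioo (0 : ℝ) 1) (r : ℝ) (hr : r ∈ Set.Ico (0 : ℝ) 1)
    (n N : ℕ) (hN : ∀ j, N < j → 0 < lam j)
    (ψ : Fin n → (onePlusAbsPow Φ lam 1).domain)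
    (u : ℝ → ℝ) (hu : u ∈ admissible δ a) (t : ℝ) (ht : 0 ≤ t) (j : Fin n) :
    ∃ h : propagator δ a A B u t (ψ j) - basisProj Φ N (propagator δ a A B u t (ψ j))
        ∈ (onePlusAbsPow Φ lam r).domain,
      ‖onePlusAbsPow Φ lam r ⟨_, h⟩‖ ≤
        Real.exp (2 / δ * a * totalVariation u) *
            (‖onePlusAbsPow Φ lam 1 (ψ j)‖ + b / a * ‖(ψ j : H)‖) /
          ⨅ k : Set.Ioi N, lam k ^ (1 - r) := by
  have hδ0 : 0 < δ := hδ.1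
  obtain ⟨hψ, hA, hG⟩ := hAB.mem_domain_of_onePlusAbs hΦ (ψ j)
  obtain ⟨hI, hIk⟩ := iInf_rpow_pos hN hΦ.tendsto (sub_pos.2 hr.2)
  set I := ⨅ k : Set.Ioi N, lam k ^ (1 - r) with hIdef
  set x : A.domain := ⟨ψ j, hψ⟩ with hx
  set y := propagator δ a A B u t (ψ j) with hy
  set E := Real.exp (2 / δ * a * totalVariation u) with hE
  set S := ‖onePlusAbsPow Φ lam 1 (ψ j)‖ with hS
  have hb := hAB.b_nonneg
  have hTV : 0 ≤ totalVariation u := ENNReal.toReal_nonneg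
  have hE1 : 1 ≤ E := Real.one_le_exp (by positivity)
  have hM : hAB.energy 0 x ≤ S + b / a * ‖(ψ j : H)‖ := by
    have e : hAB.energy 0 x = ‖A x‖ + b / a * ‖(x : H)‖ := by simp [KatoPair.energy]
    rw [e]
    exact add_le_add hA le_rfl
  have hG' : hAB.shiftedEnergy 0 x ≤ S := by
    simpa [KatoPair.shiftedEnergy] using hG
  set R := hAB.shiftedEnergy 0 x + (E - 1) * hAB.energy 0 x with hR
  have hR0 : 0 ≤ R := add_nonneg (norm_nonneg _)
    (mul_nonneg (sub_nonneg.2 hE1) (hAB.energy_nonneg _ _))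
  -- The shifted energy contributes `S` and the growth `(E - 1)(S + (b/a)‖ψ‖)`, so the factor of `S`
  -- is exactly `E`.
  have hRle : R ≤ E * (S + b / a * ‖(ψ j : H)‖) := by
    have h1 := mul_le_mul_of_nonneg_left hM (sub_nonneg.2 hE1)
    have h2 : 0 ≤ b / a * ‖(ψ j : H)‖ := by positivity
    linarith
  have hsum : ∀ s : Finset ℕ, ∑ k ∈ s, (|1 + lam k| * ‖⟪Φ k, y⟫_ℂ‖) ^ 2 ≤ R ^ 2 := by
    intro s
    have h := hAB.sum_coeff_propagator_le hΦ ha hδ0 hu ht x s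
    have e : 2 * (a / δ) * totalVariation u = 2 / δ * a * totalVariation u := by ring
    rwa [e] at h
  obtain ⟨h, hle⟩ := exists_mem_diagOp_domain Φ (c := fun k => (1 + |lam k|) ^ r)
    (x := y - basisProj Φ N y) (R := R / I) (by positivity) fun s => by
      rw [div_pow, le_div_iff₀ (by positivity), Finset.sum_mul]
      refine (Finset.sum_le_sum fun k _ => ?_).trans (hsum s)
      rw [← mul_pow]
      refine pow_le_pow_left₀ (by positivity) ?_ 2
      rw [inner_basis_basisProj]
      split_ifs with hk
      · rw [mul_zero, norm_zero, zero_mul]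
        positivity
      · have hlk := hN k (not_le.1 hk)
        have h1 := one_add_rpow_le hlk hr.2 hI (hIk k (not_le.1 hk))
        rw [le_div_iff₀ hI] at h1
        have h2 : 0 < 1 + lam k := by linarith
        rw [norm_mul, Complex.norm_real, abs_of_pos hlk, abs_of_pos h2,
          Real.norm_of_nonneg (Real.rpow_nonneg h2.le _), mul_right_comm]
        exact mul_le_mul_of_nonneg_right h1 (norm_nonneg _)
  exact ⟨h, hle.trans (div_le_div_of_nonneg_right hRle hI.le)⟩
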